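/- **Terms.** Let $C$ be a set of constants and let $\bot$ be a further, distinguished constant. $\Lambda^\infty$ is the set of all finite and infinite lambda terms given by the coinductively read grammar $t ::= c \mid \bot \mid x \mid t\,t \mid \lambda t$ with $c\in C$, represented with de Bruijn indices $x\in\mathbb N$ (a loose index is a free variable). Atoms are the variables and the constants, including $\bot$. For $n\in\mathbb N$, $t[s/n]$ is capture-avoiding substitution of $s$ for the free index $n$ in $t$ (the index $n$ disappears: free indices above $n$ are lowered by $1$), and ${\uparrow}t$ is $t$ with all free indices raised by $1$. **Reductions.** For $R\subseteq\Lambda^\infty\times\Lambda^\infty$, $\to_R$ is the compatible closure of $R$: inductively, $s\to_R t$ if $(s,t)\in R$; if $s\to_R s'$ then $s\,t\to_R s'\,t$, $t\,s\to_R t\,s'$ and $\lambda s\to_R\lambda s'$. The depth of the contracted redex in such a step is the number of uses of the last three rules. For a relation $\to$ on $\Lambda^\infty$ with reflexive-transitive closure $\to^*$, the infinitary closure $\to^\infty$ is the greatest relation such that $s\to^\infty u$ implies one of: $u$ is an atom and $s\to^* u$; or $u=t_1't_2'$ and $s\to^* t_1t_2$ with $t_i\to^\infty t_i'$ $(i=1,2)$;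 or $u=\lambda r'$ and $s\to^*\lambda r$ with $r\to^\infty r'$. The relation $\to$ is *appendable* if $t_1\to^\infty t_2\to t_3$ implies $t_1\to^\infty t_3$. **Strong convergence.** Let $d(t,s)=\inf\{2^{-n}\mid n\in\mathbb N,\ t{\upharpoonright}n=s{\upharpoonright}n\}$, where $r{\upharpoonright}n$ is $r$ with all subterms at depth $n$ replaced by $\bot$. A *strongly convergent $R$-reduction sequence of length $\zeta$ from $s$ to $t$* ($\zeta$ an ordinal) consists of terms $f(\gamma)$ for $\gamma\le\zeta$ with $f(0)=s$, $f(\zeta)=t$, and steps $f(\gamma)\to_R f(\gamma+1)$ for $\gamma<\zeta$, such that for every limit ordinal $\delta\le\zeta$: $f(\delta)$ is the limit of $(f(\gamma))_{\gamma<\delta}$ in the metric $d$; and for every $k\in\mathbb N$ there is $\gamma<\delta$ such that for all $\gamma\le\gamma'<\delta$ the redex contracted in the step from $f(\gamma')$ to $f(\gamma'+1)$ occurs at depth greater than $k$. **Meaningless terms.** Let $R_\beta=\{((\lambda s)\,t,\ s[t/0])\}$, $\to_\beta$ its compatible closure and $\to^\infty_\beta$ the infinitary closure of $\to_\beta$.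 A term is in root normal form if it is an atom other than $\bot$, or an abstraction, or an application $t_1t_2$ such that there is no $s$ with $t_1\to^\infty_\beta\lambda s$. It is root-active if it has no infinitary $\beta$-reduct in root normal form. A set $U\subseteq\Lambda^\infty$ is *strongly meaningless* if: 1. (Closure) $t\in U$ and $t\to^\infty_\beta s$ imply $s\in U$. 2. (Substitution) $t\in U$ implies $t[s/n]\in U$ for all terms $s$ and all $n$, and ${\uparrow}t\in U$. 3. (Overlap) $\lambda s\in U$ implies $(\lambda s)\,t\in U$ for all $t$. 4. (Root-activeness) All root-active terms are in $U$. 5. (Indiscernibility) $t\in U$ and $t\sim_U s$ imply $s\in U$, where $\sim_U$ is the greatest relation such that $t\sim_U s$ implies one of: $t,s\in U$; $t=s$ is an atom; $t=t_1t_2$, $s=s_1s_2$ with $t_i\sim_U s_i$; $t=\lambda t'$, $s=\lambda s'$ with $t'\sim_U s'$. 6. (Expansion) $t\in U$ and $s\to^\infty_\beta t$ imply $s\in U$. Put $R_{\beta\bot_U}=R_\beta\cup\{(t,\bot)\mid t\in U,\ t\ne\bot\}$, and let $\to^\infty_{\beta\bot_U}$ be the infinitary closure of $\to_{\beta\bot_U}$,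 the compatible closure of $R_{\beta\bot_U}$. **Theorem.** (a) ($\omega$-compression) Let $R\subseteq\Lambda^\infty\times\Lambda^\infty$ be such that $\to_R$ is appendable. If there is a strongly convergent $R$-reduction sequence from $s$ to $t$, of any ordinal length, then there is one of length at most $\omega$. (b) Let $U$ be a strongly meaningless set. For all $s,t\in\Lambda^\infty$: $s\to^\infty_{\beta\bot_U}t$ if and only if there is a strongly convergent $R_{\beta\bot_U}$-reduction sequence, of some ordinal length, from $s$ to $t$. (c) For all $s,t\in\Lambda^\infty$: $s\to^\infty_\beta t$ if and only if there is a strongly convergent $R_\beta$-reduction sequence, of some ordinal length, from $s$ to $t$. -/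

import Mathlib

universe u v

namespace InfLambda

/-! ### Infinitary lambda terms (with de Bruijn indices) -/

/-- Node labels. The set of constants is `C` together with the distinguished constant `bot`. -/
inductive Label (C : Type u) : Type u
  | var (n : ℕ)
  | bot
  | const (c : C)
  | app
  | lam

/-- The polynomial functor of the grammar `C | V | Λ Λ | λ Λ`: atoms have no children,
an application has two (`false` is the function, `true` the argument), an abstraction one. -/
def sig (C : Type u) : PFunctor.{u, 0} where
  A := Label C
  B := fun l => match l with
    | .var _ => Empty
    | .bot => Empty
    | .const _ => Empty
    | .app => Bool
    | .lam => Unit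

/-- All finite and infinite lambda terms: the final coalgebra of `sig C`. Variables are
de Bruijn indices; a loose index denotes a free variable. -/
def Term (C : Type u) : Type u := (sig C).M

namespace Term

variable {C : Type u}

/-- The term with a given root label and given immediate subterms. -/
def mk (x : (sig C).Obj (Term C)) : Term C := PFunctor.M.mk (F := sig C) x

/-- The label at the root and the immediate subterms. -/
def dest (t : Term C) : (sig C).Obj (Term C) := PFunctor.M.dest (F := sig C) t

def var (n : ℕ) : Term C := mk ⟨Label.var n, Empty.elim⟩
def bot : Term C := mk ⟨Label.bot, Empty.elim⟩
def const (c : C) : Term C := mk ⟨Label.const c, Empty.elim⟩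
def app (t₁ t₂ : Term C) : Term C :=
  mk ⟨Label.app, fun b : Bool => if b then t₂ else t₁⟩
def lam (t : Term C) : Term C := mk ⟨Label.lam, fun _ : Unit => t⟩

/-- Variables and constants (including `bot`). -/
def IsAtom (a : Term C) : Prop := (∃ n, a = var n) ∨ a = bot ∨ ∃ c, a = const c

/-! #### Renaming and substitution, by guarded corecursion -/

/-- The renaming that `ρ` induces below a binder. -/
def upRen (ρ : ℕ → ℕ) : ℕ → ℕ
  | 0 => 0
  | n + 1 => ρ n + 1

def renameStep (ρ : ℕ → ℕ) : (sig C).Obj (Term C) → (sig C).Obj ((ℕ → ℕ) × Term C)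
  | ⟨.var n, _⟩ => ⟨Label.var (ρ n), Empty.elim⟩
  | ⟨.bot, _⟩ => ⟨Label.bot, Empty.elim⟩
  | ⟨.const c, _⟩ => ⟨Label.const c, Empty.elim⟩
  | ⟨.app, k⟩ => ⟨Label.app, fun b => (ρ, k b)⟩
  | ⟨.lam, k⟩ => ⟨Label.lam, fun b => (upRen ρ, k b)⟩

/-- Replacing every free index `n` by `ρ n`. -/
def rename (ρ : ℕ → ℕ) (t : Term C) : Term C :=
  PFunctor.M.corec (F := sig C) (fun p : (ℕ → ℕ) × Term C => renameStep p.1 (dest p.2)) (ρ, t)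

/-- Adding `1` to every free index. -/
def shift (t : Term C) : Term C := rename Nat.succ t

/-- The substitution that `σ` induces below a binder. -/
def upSub (σ : ℕ → Term C) : ℕ → Term C
  | 0 => var 0
  | n + 1 => shift (σ n)

/-- A state `inl t` is a finished term `t`; a state `inr (σ, t)` stands for the result of
applying `σ` to `t`. -/
def substNode (σ : ℕ → Term C) :
    (sig C).Obj (Term C) → (sig C).Obj (Term C ⊕ ((ℕ → Term C) × Term C))
  | ⟨.var n, _⟩ => (sig C).map Sum.inl (dest (σ n))
  | ⟨.bot, _⟩ => ⟨Label.bot, Empty.elim⟩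
  | ⟨.const c, _⟩ => ⟨Label.const c, Empty.elim⟩
  | ⟨.app, k⟩ => ⟨Label.app, fun b => .inr (σ, k b)⟩
  | ⟨.lam, k⟩ => ⟨Label.lam, fun b => .inr (upSub σ, k b)⟩

def substStep : Term C ⊕ ((ℕ → Term C) × Term C) →
    (sig C).Obj (Term C ⊕ ((ℕ → Term C) × Term C))
  | .inl t => (sig C).map Sum.inl (dest t)
  | .inr (σ, t) => substNode σ (dest t)

/-- Simultaneous capture-avoiding substitution of `σ n` for each free index `n`. -/
def subst (σ : ℕ → Term C) (t : Term C) : Term C := PFunctor.M.corec substStep (.inr (σ, t))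

/-- `t.substAt n s` substitutes `s` for the free index `n` in `t`. The index `n` disappears,
so the free indices above `n` are lowered by one. -/
def substAt (t : Term C) (n : ℕ) (s : Term C) : Term C :=
  subst (fun m => if m < n then var m else if m = n then s else var (m - 1)) t

/-! #### The defining equations of renaming and substitution -/

section Equations

theorem mk_dest (t : Term C) : mk (dest t) = t := PFunctor.M.mk_dest t

theorem ext_dest {s t : Term C} (h : dest s = dest t) : s = t := by
  rw [← mk_dest s, ← mk_dest t, h]

theorem dest_mk (x : (sig C).Obj (Term C)) : dest (mk x) = x :=
  PFunctor.M.dest_mk x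

theorem corec_inl (t : Term C) : PFunctor.M.corec substStep (.inl t) = t := by
  refine PFunctor.M.bisim (P := sig C)
    (fun a b => a = PFunctor.M.corec substStep (.inl b)) ?_ _ _ rfl
  rintro _ y rfl
  exact ⟨(dest y).1, _, (dest y).2, PFunctor.M.dest_corec _ _, rfl, fun i => rfl⟩

theorem rename_mk (ρ : ℕ → ℕ) (x : (sig C).Obj (Term C)) :
    rename ρ (mk x) =
      mk ((sig C).map (fun p => rename p.1 p.2) (renameStep ρ x)) := by
  apply ext_dest
  rw [dest_mk]
  refine (PFunctor.M.dest_corec _ _).trans ?_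
  exact congrArg (fun y => (sig C).map (fun p => rename p.1 p.2) (renameStep ρ y)) (dest_mk x)

theorem subst_mk (σ : ℕ → Term C) (x : (sig C).Obj (Term C)) :
    subst σ (mk x) =
      mk ((sig C).map (PFunctor.M.corec substStep) (substNode σ x)) := by
  apply ext_dest
  rw [dest_mk]
  refine (PFunctor.M.dest_corec _ _).trans ?_
  exact congrArg (fun y => (sig C).map (PFunctor.M.corec substStep) (substNode σ y)) (dest_mk x)

theorem mk_congr (l : Label C) {f g : (sig C).B l → Term C} (h : ∀ b, f b = g b) :
    mk ⟨l, f⟩ = mk ⟨l, g⟩ := by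
  rw [funext h]

theorem rename_var (ρ : ℕ → ℕ) (n : ℕ) : rename ρ (var n : Term C) = var (ρ n) :=
  (rename_mk _ _).trans (mk_congr _ fun b : Empty => b.elim)

theorem rename_bot (ρ : ℕ → ℕ) : rename ρ (bot : Term C) = bot :=
  (rename_mk _ _).trans (mk_congr _ fun b : Empty => b.elim)

theorem rename_const (ρ : ℕ → ℕ) (c : C) : rename ρ (const c) = const c :=
  (rename_mk _ _).trans (mk_congr _ fun b : Empty => b.elim)

theorem rename_app (ρ : ℕ → ℕ) (t₁ t₂ : Term C) :
    rename ρ (app t₁ t₂) = app (rename ρ t₁) (rename ρ t₂) :=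
  (rename_mk _ _).trans (mk_congr _ fun b : Bool => by cases b <;> rfl)

theorem rename_lam (ρ : ℕ → ℕ) (t : Term C) :
    rename ρ (lam t) = lam (rename (upRen ρ) t) :=
  (rename_mk _ _).trans (mk_congr _ fun _ : Unit => rfl)

theorem subst_var (σ : ℕ → Term C) (n : ℕ) : subst σ (var n) = σ n := by
  refine (subst_mk _ _).trans ?_
  refine Eq.trans (congrArg _ ?_) (mk_dest (σ n))
  exact congrArg (fun f => (sig C).map f (dest (σ n))) (funext corec_inl)

theorem subst_bot (σ : ℕ → Term C) : subst σ bot = bot :=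
  (subst_mk _ _).trans (mk_congr _ fun b : Empty => b.elim)

theorem subst_const (σ : ℕ → Term C) (c : C) : subst σ (const c) = const c :=
  (subst_mk _ _).trans (mk_congr _ fun b : Empty => b.elim)

theorem subst_app (σ : ℕ → Term C) (t₁ t₂ : Term C) :
    subst σ (app t₁ t₂) = app (subst σ t₁) (subst σ t₂) :=
  (subst_mk _ _).trans (mk_congr _ fun b : Bool => by cases b <;> rfl)

theorem subst_lam (σ : ℕ → Term C) (t : Term C) :
    subst σ (lam t) = lam (subst (upSub σ) t) :=
  (subst_mk _ _).trans (mk_congr _ fun _ : Unit => rfl)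

end Equations

/-! #### The metric -/

/-- `trunc n t` replaces all subterms of `t` at depth `n` by `bot`. -/
def trunc : ℕ → Term C → Term C
  | 0, _ => bot
  | n + 1, t => mk ((sig C).map (trunc n) (dest t))

/-- The metric `d(t,s) = inf {2⁻ⁿ | trunc n t = trunc n s}` on infinitary terms. -/
noncomputable def dist (t s : Term C) : ℝ :=
  sInf {x : ℝ | ∃ n : ℕ, trunc n t = trunc n s ∧ x = (2 : ℝ)⁻¹ ^ n}

end Term

open Term

variable {C : Type u}

/-! ### Closures of relations -/

/-- The compatible closure `→_R`. -/
inductive Compat (R : Term C → Term C → Prop) : Term C → Term C → Prop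
  | base {s t} : R s t → Compat R s t
  | appL {s s' t} : Compat R s s' → Compat R (app s t) (app s' t)
  | appR {s t t'} : Compat R t t' → Compat R (app s t) (app s t')
  | lam {s s'} : Compat R s s' → Compat R (lam s) (lam s')

/-- `StepAt R d s t`: there is a step `s →_R t` whose contracted redex occurs at depth `d`. -/
inductive StepAt (R : Term C → Term C → Prop) : ℕ → Term C → Term C → Prop
  | base {s t} : R s t → StepAt R 0 s t
  | appL {d s s' t} : StepAt R d s s' → StepAt R (d + 1) (app s t) (app s' t)
  | appR {d s t t'} : StepAt R d t t' → StepAt R (d + 1) (app s t) (app s t')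
  | lam {d s s'} : StepAt R d s s' → StepAt R (d + 1) (lam s) (lam s')

theorem compat_iff_exists_stepAt {R : Term C → Term C → Prop} {s t : Term C} :
    Compat R s t ↔ ∃ d, StepAt R d s t := by
  constructor
  · intro h
    induction h with
    | base h => exact ⟨0, .base h⟩
    | appL _ ih => obtain ⟨d, hd⟩ := ih; exact ⟨d + 1, .appL hd⟩
    | appR _ ih => obtain ⟨d, hd⟩ := ih; exact ⟨d + 1, .appR hd⟩
    | lam _ ih => obtain ⟨d, hd⟩ := ih; exact ⟨d + 1, .lam hd⟩
  · rintro ⟨d, h⟩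
    induction h with
    | base h => exact .base h
    | appL _ ih => exact .appL ih
    | appR _ ih => exact .appR ih
    | lam _ ih => exact .lam ih

/-- The rules of the parallel closure of `R`, with premises in `X`. -/
inductive ParRule (R X : Term C → Term C → Prop) : Term C → Term C → Prop
  | base {s t} : R s t → ParRule R X s t
  | atom {a} : IsAtom a → ParRule R X a a
  | app {s₁ s₂ t₁ t₂} : X s₁ t₁ → X s₂ t₂ → ParRule R X (app s₁ s₂) (app t₁ t₂)
  | lam {s s'} : X s s' → ParRule R X (lam s) (lam s')

/-- The parallel closure of `R`: the greatest relation closed backwards under `ParRule`. -/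
def Par (R : Term C → Term C → Prop) (s t : Term C) : Prop :=
  ∃ X : Term C → Term C → Prop, (∀ s t, X s t → ParRule R X s t) ∧ X s t

/-- The rules of the infinitary closure of `r`, with coinductive premises in `X`. -/
inductive InfRule (r X : Term C → Term C → Prop) : Term C → Term C → Prop
  | atom {s a} : IsAtom a → Relation.ReflTransGen r s a → InfRule r X s a
  | app {s t₁ t₂ t₁' t₂'} : Relation.ReflTransGen r s (app t₁ t₂) → X t₁ t₁' → X t₂ t₂' →
      InfRule r X s (app t₁' t₂')
  | lam {s t t'} : Relation.ReflTransGen r s (lam t) → X t t' → InfRule r X s (lam t')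

/-- The infinitary closure `→^∞` of `r`: the greatest relation closed backwards under
`InfRule`. -/
def InfClosure (r : Term C → Term C → Prop) (s t : Term C) : Prop :=
  ∃ X : Term C → Term C → Prop, (∀ s t, X s t → InfRule r X s t) ∧ X s t

/-- A relation `→` is appendable if `t₁ →^∞ t₂ → t₃` implies `t₁ →^∞ t₃`. -/
def Appendable (r : Term C → Term C → Prop) : Prop :=
  ∀ t₁ t₂ t₃, InfClosure r t₁ t₂ → r t₂ t₃ → InfClosure r t₁ t₃

/-! ### Strongly convergent reductions -/

/-- A strongly convergent `R`-reduction sequence of length `ζ` from `s` to `t`. Only the values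
`f γ` with `γ ≤ ζ` and `depth γ` with `γ < ζ` matter; `depth γ` is the depth at which the redex
contracted in the step from `f γ` to `f (γ + 1)` occurs. -/
structure StrongConvSeq (R : Term C → Term C → Prop) (ζ : Ordinal.{v}) (s t : Term C) where
  f : Ordinal.{v} → Term C
  depth : Ordinal.{v} → ℕ
  f_zero : f 0 = s
  f_last : f ζ = t
  step : ∀ γ < ζ, StepAt R (depth γ) (f γ) (f (γ + 1))
  tendsto_limit : ∀ δ ≤ ζ, Order.IsSuccLimit δ → ∀ ε > (0 : ℝ),
    ∃ γ < δ, ∀ γ', γ ≤ γ' → γ' < δ → Term.dist (f γ') (f δ) < ε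
  depth_limit : ∀ δ ≤ ζ, Order.IsSuccLimit δ → ∀ d : ℕ,
    ∃ γ < δ, ∀ γ', γ ≤ γ' → γ' < δ → d < depth γ'

/-! ### Beta reduction, meaningless terms and Böhm reduction -/

/-- The relation `R_β`. -/
inductive BetaRule : Term C → Term C → Prop
  | mk (s t : Term C) : BetaRule (app (lam s) t) (s.substAt 0 t)

/-- Infinitary `β`-reduction `→^∞_β`. -/
def InfBeta : Term C → Term C → Prop := InfClosure (Compat BetaRule)

/-- Root normal forms. -/
def IsRnf (t : Term C) : Prop :=
  (IsAtom t ∧ t ≠ bot) ∨ (∃ t', t = lam t') ∨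
    ∃ t₁ t₂, t = app t₁ t₂ ∧ ¬ ∃ s, InfBeta t₁ (lam s)

/-- The set of root-active terms: those that have no root normal form. -/
def rootActive (C : Type u) : Set (Term C) := {t | ¬ ∃ t', InfBeta t t' ∧ IsRnf t'}

/-- Sets of meaningless terms. A term `t` considered in the presence of one more variable is
`t.shift` when de Bruijn indices are used. Closure under `shift` is the part of the substitution
axiom that concerns this re-indexing: together, the two `substitution` fields give closure under
all substitutions for finitely many variables, the other ones being renumbered by an offset. -/
structure Meaningless (U : Set (Term C)) : Prop where
  closure : ∀ t s, t ∈ U → InfBeta t s → s ∈ U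
  substitution : ∀ t ∈ U, ∀ (n : ℕ) (s : Term C), t.substAt n s ∈ U
  substitution_shift : ∀ t ∈ U, t.shift ∈ U
  overlap : ∀ s t, lam s ∈ U → app (lam s) t ∈ U
  root_active : rootActive C ⊆ U
  indiscernibility : ∀ t s, t ∈ U → Par (fun a b => a ∈ U ∧ b ∈ U) t s → s ∈ U

/-- Sets of strongly meaningless terms. -/
structure StronglyMeaningless (U : Set (Term C)) : Prop extends Meaningless U where
  expansion : ∀ t s, t ∈ U → InfBeta s t → s ∈ U

/-- The relation `R_{⊥_U}`. -/
def BotRule (U : Set (Term C)) (t s : Term C) : Prop := t ∈ U ∧ t ≠ bot ∧ s = bot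

/-- The relation `R_{β⊥_U} = R_β ∪ R_{⊥_U}`. -/
def BetaBotRule (U : Set (Term C)) (t s : Term C) : Prop := BetaRule t s ∨ BotRule U t s

/-- Infinitary `β⊥_U`-reduction (Böhm reduction over `U`). -/
def InfBetaBot (U : Set (Term C)) : Term C → Term C → Prop :=
  InfClosure (Compat (BetaBotRule U))

end InfLambda

/-!
For an appendable compatible closure `→_R`, strongly convergent reduction sequences and the
coinductively defined infinitary closure describe the same relation, so that every sequence can be
compressed through the infinitary closure.

From the infinitary closure to sequences (`InfClosure.exists_strongConvSeq`, for arbitrary `R`): a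
proof of `s →^∞ t` is unfolded level by level. At each level `n` finitely many subterms occur at
depth `n`, so finitely many steps at depth at least `n` make the current term agree with `t` one
level further (`InfBelow.next`). The concatenation of these finite reductions has length at most
`ω`, and its depths tend to infinity.

From sequences to the infinitary closure (`StrongConvSeq.infClosure`, for appendable `→_R`):
induction on the ordinal at which the sequence ends, with appendability at successors. At a limit,
some final segment has no step at the root, hence splits into sequences of immediate subterms; the
claim follows by coinduction.

It remains to see that `→_β` and `→_{β⊥_U}` are appendable. A `β`-step can be appended because
infinitary reduction is compatible with substitution (`InfClosure.substAt_zero`); for `→_{β⊥_U}`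
this uses that `U` is closed under the substitutions that occur (`Meaningless.subst_mem`). To append
a contraction of `t ∈ U` to `⊥`, it suffices that `s →^∞_{β⊥_U} t ∈ U` implies `s ∈ U`. Indeed, the
`⊥`-steps can be postponed: `s →^∞_β r` for some `r` from which `t` arises by replacing subterms in
`U` by `⊥` (`Meaningless.infClosure_postpone`); then `r ∈ U` by indiscernibility, and `s ∈ U` by
expansion.
-/

namespace InfLambda

/-! ### Terms: roots, immediate subterms, coinductive equality -/

namespace Term

variable {C : Type u}

/-- The label at the root of a term. -/
def root (t : Term C) : Label C := (dest t).1

/-- The function part of an application; `bot` for a term of another shape. -/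
def left (t : Term C) : Term C :=
  match dest t with
  | ⟨.app, k⟩ => k false
  | _ => bot

/-- The argument of an application; `bot` for a term of another shape. -/
def right (t : Term C) : Term C :=
  match dest t with
  | ⟨.app, k⟩ => k true
  | _ => bot

/-- The body of an abstraction; `bot` for a term of another shape. -/
def body (t : Term C) : Term C :=
  match dest t with
  | ⟨.lam, k⟩ => k ()
  | _ => bot

@[simp] theorem dest_var (n : ℕ) : dest (var n : Term C) = ⟨Label.var n, Empty.elim⟩ := dest_mk _
@[simp] theorem dest_bot : dest (bot : Term C) = ⟨Label.bot, Empty.elim⟩ := dest_mk _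
@[simp] theorem dest_const (c : C) : dest (const c) = ⟨Label.const c, Empty.elim⟩ := dest_mk _
@[simp] theorem dest_app (a b : Term C) :
    dest (app a b) = ⟨Label.app, fun i : Bool => if i then b else a⟩ := dest_mk _
@[simp] theorem dest_lam (a : Term C) : dest (lam a) = ⟨Label.lam, fun _ : Unit => a⟩ := dest_mk _

@[simp] theorem root_var (n : ℕ) : root (var n : Term C) = .var n := by simp [root]
@[simp] theorem root_bot : root (bot : Term C) = .bot := by simp [root]
@[simp] theorem root_const (c : C) : root (const c) = .const c := by simp [root]
@[simp] theorem root_app (a b : Term C) : root (app a b) = .app := by simp [root]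
@[simp] theorem root_lam (a : Term C) : root (lam a) = .lam := by simp [root]

@[simp] theorem left_app (a b : Term C) : left (app a b) = a := by simp [left]
@[simp] theorem right_app (a b : Term C) : right (app a b) = b := by simp [right]
@[simp] theorem body_lam (a : Term C) : body (lam a) = a := by simp [body]
@[simp] theorem left_lam (a : Term C) : left (lam a) = bot := by simp [left]
@[simp] theorem right_lam (a : Term C) : right (lam a) = bot := by simp [right]
@[simp] theorem body_app (a b : Term C) : body (app a b) = bot := by simp [body]

@[simp] theorem app_inj {a b a' b' : Term C} : app a b = app a' b' ↔ a = a' ∧ b = b' :=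
  ⟨fun h => ⟨by simpa using congrArg left h, by simpa using congrArg right h⟩,
    fun ⟨h, h'⟩ => by rw [h, h']⟩

@[simp] theorem lam_inj {a a' : Term C} : lam a = lam a' ↔ a = a' :=
  ⟨fun h => by simpa using congrArg body h, fun h => by rw [h]⟩

@[simp] theorem app_ne_lam (a b c : Term C) : app a b ≠ lam c :=
  fun h => by simpa using congrArg root h
@[simp] theorem lam_ne_app (a b c : Term C) : lam c ≠ app a b :=
  fun h => by simpa using congrArg root h
@[simp] theorem app_ne_bot (a b : Term C) : app a b ≠ bot :=
  fun h => by simpa using congrArg root h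
@[simp] theorem lam_ne_bot (a : Term C) : lam a ≠ bot :=
  fun h => by simpa using congrArg root h

@[simp] theorem isAtom_var (n : ℕ) : IsAtom (var n : Term C) := .inl ⟨n, rfl⟩
@[simp] theorem isAtom_bot : IsAtom (bot : Term C) := .inr (.inl rfl)
@[simp] theorem isAtom_const (c : C) : IsAtom (const c) := .inr (.inr ⟨c, rfl⟩)

@[simp] theorem not_isAtom_app (a b : Term C) : ¬ IsAtom (app a b) := by
  rintro (⟨n, h⟩ | h | ⟨c, h⟩) <;> simpa using congrArg root h

@[simp] theorem not_isAtom_lam (a : Term C) : ¬ IsAtom (lam a) := by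
  rintro (⟨n, h⟩ | h | ⟨c, h⟩) <;> simpa using congrArg root h

theorem atom_or_app_or_lam (t : Term C) :
    IsAtom t ∨ (∃ a b, t = app a b) ∨ ∃ a, t = lam a := by
  rw [← mk_dest t]
  rcases dest t with ⟨l, k⟩
  cases l with
  | var n => exact .inl (.inl ⟨n, mk_congr _ fun b : Empty => b.elim⟩)
  | bot => exact .inl (.inr (.inl (mk_congr _ fun b : Empty => b.elim)))
  | const c => exact .inl (.inr (.inr ⟨c, mk_congr _ fun b : Empty => b.elim⟩))
  | app => exact .inr (.inl ⟨k false, k true, mk_congr _ fun b : Bool => by cases b <;> rfl⟩)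
  | lam => exact .inr (.inr ⟨k (), mk_congr _ fun _ : Unit => rfl⟩)

/-- Case analysis on the root of a term. -/
@[elab_as_elim]
theorem shapeCases {motive : Term C → Prop} (t : Term C)
    (var : ∀ n, motive (var n)) (bot : motive bot) (const : ∀ c, motive (const c))
    (app : ∀ a b, motive (app a b)) (lam : ∀ a, motive (lam a)) : motive t := by
  rcases atom_or_app_or_lam t with (⟨n, rfl⟩ | rfl | ⟨c, rfl⟩) | ⟨a, b, rfl⟩ | ⟨a, rfl⟩
  exacts [var n, bot, const c, app a b, lam a]

/-- The rules for equality of terms, with premises in `X`. -/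
inductive EqRule (X : Term C → Term C → Prop) : Term C → Term C → Prop
  | refl (t) : EqRule X t t
  | app {a b a' b'} : X a a' → X b b' → EqRule X (app a b) (app a' b')
  | lam {a a'} : X a a' → EqRule X (lam a) (lam a')

/-- Coinduction principle for equality of terms. -/
theorem eq_of_bisim (X : Term C → Term C → Prop) (hX : ∀ s t, X s t → EqRule X s t)
    {s t : Term C} (h : X s t) : s = t := by
  refine PFunctor.M.bisim (P := sig C) (fun a b => a = b ∨ X a b) ?_ s t (.inr h)
  rintro a b (rfl | h)
  · exact ⟨(dest a).1, (dest a).2, (dest a).2, rfl, rfl, fun i => .inl rfl⟩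
  · cases hX _ _ h with
    | refl => exact ⟨(dest a).1, (dest a).2, (dest a).2, rfl, rfl, fun i => .inl rfl⟩
    | app h₁ h₂ =>
      refine ⟨Label.app, _, _, dest_app _ _, dest_app _ _, fun i : Bool => ?_⟩
      cases i
      exacts [.inr h₁, .inr h₂]
    | lam h₁ => exact ⟨Label.lam, _, _, dest_lam _, dest_lam _, fun i : Unit => .inr h₁⟩

attribute [simp] rename_var rename_bot rename_const rename_app rename_lam
  subst_var subst_bot subst_const subst_app subst_lam

/-! ### Truncation and the metric -/

@[simp] theorem trunc_succ_app (n : ℕ) (a b : Term C) :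
    trunc (n + 1) (app a b) = app (trunc n a) (trunc n b) := by
  rw [trunc, dest_app]
  exact mk_congr _ fun b : Bool => by cases b <;> rfl

@[simp] theorem trunc_succ_lam (n : ℕ) (a : Term C) :
    trunc (n + 1) (lam a) = lam (trunc n a) := by
  rw [trunc, dest_lam]
  exact mk_congr _ fun b : Unit => rfl

theorem trunc_succ_atom (n : ℕ) {a : Term C} (ha : IsAtom a) : trunc (n + 1) a = a := by
  rw [trunc]
  rcases ha with ⟨m, rfl⟩ | rfl | ⟨c, rfl⟩
  · rw [dest_var]; exact mk_congr _ fun b : Empty => b.elim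
  · rw [dest_bot]; exact mk_congr _ fun b : Empty => b.elim
  · rw [dest_const]; exact mk_congr _ fun b : Empty => b.elim

@[simp] theorem root_trunc_succ (n : ℕ) (t : Term C) : root (trunc (n + 1) t) = root t := by
  rcases atom_or_app_or_lam t with h | ⟨a, b, rfl⟩ | ⟨a, rfl⟩
  · rw [trunc_succ_atom n h]
  · simp
  · simp

theorem eq_of_root_eq_of_isAtom {s t : Term C} (ht : IsAtom t) (h : root s = root t) : s = t := by
  rcases ht with ⟨m, rfl⟩ | rfl | ⟨c, rfl⟩ <;>
    induction s using shapeCases <;> simp_all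

theorem eq_app_of_root {s : Term C} (h : root s = .app) : s = app (left s) (right s) := by
  induction s using shapeCases <;> simp_all

theorem eq_lam_of_root {s : Term C} (h : root s = .lam) : s = lam (body s) := by
  induction s using shapeCases <;> simp_all

@[simp] theorem trunc_bot (n : ℕ) : trunc n (bot : Term C) = bot := by
  cases n with
  | zero => rfl
  | succ n => exact trunc_succ_atom n isAtom_bot

theorem left_of_isAtom {a : Term C} (h : IsAtom a) : left a = bot := by
  rcases h with ⟨m, rfl⟩ | rfl | ⟨c, rfl⟩ <;> simp [left]
theorem right_of_isAtom {a : Term C} (h : IsAtom a) : right a = bot := by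
  rcases h with ⟨m, rfl⟩ | rfl | ⟨c, rfl⟩ <;> simp [right]
theorem body_of_isAtom {a : Term C} (h : IsAtom a) : body a = bot := by
  rcases h with ⟨m, rfl⟩ | rfl | ⟨c, rfl⟩ <;> simp [body]

theorem left_trunc_succ (n : ℕ) (t : Term C) : left (trunc (n + 1) t) = trunc n (left t) := by
  rcases atom_or_app_or_lam t with h | ⟨a, b, rfl⟩ | ⟨a, rfl⟩
  · simp [trunc_succ_atom n h, left_of_isAtom h]
  all_goals simp

theorem right_trunc_succ (n : ℕ) (t : Term C) : right (trunc (n + 1) t) = trunc n (right t) := by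
  rcases atom_or_app_or_lam t with h | ⟨a, b, rfl⟩ | ⟨a, rfl⟩
  · simp [trunc_succ_atom n h, right_of_isAtom h]
  all_goals simp

theorem body_trunc_succ (n : ℕ) (t : Term C) : body (trunc (n + 1) t) = trunc n (body t) := by
  rcases atom_or_app_or_lam t with h | ⟨a, b, rfl⟩ | ⟨a, rfl⟩
  · simp [trunc_succ_atom n h, body_of_isAtom h]
  all_goals simp

theorem root_eq_of_trunc_eq {n : ℕ} {s t : Term C} (h : trunc (n + 1) s = trunc (n + 1) t) :
    root s = root t := by
  simpa using congrArg root h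

theorem trunc_eq_of_le {m n : ℕ} {s t : Term C} (hmn : m ≤ n) (h : trunc n s = trunc n t) :
    trunc m s = trunc m t := by
  induction m generalizing n s t with
  | zero => rfl
  | succ m ih =>
    obtain ⟨n, rfl⟩ := Nat.exists_eq_add_of_le' (Nat.one_le_of_lt hmn)
    have hr := root_eq_of_trunc_eq h
    have hl := congrArg left h
    have hr' := congrArg right h
    have hb := congrArg body h
    simp only [left_trunc_succ, right_trunc_succ, body_trunc_succ] at hl hr' hb
    have hle : m ≤ n := by omega
    rcases atom_or_app_or_lam t with ht | ⟨a, b, rfl⟩ | ⟨a, rfl⟩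
    · rw [eq_of_root_eq_of_isAtom ht hr]
    · rw [eq_app_of_root (s := s) (by simpa using hr)]
      simpa using And.intro (ih hle hl) (ih hle hr')
    · rw [eq_lam_of_root (s := s) (by simpa using hr)]
      simpa using ih hle hb

theorem eq_of_trunc_eq {s t : Term C} (h : ∀ n, trunc n s = trunc n t) : s = t := by
  refine eq_of_bisim (fun s t => ∀ n, trunc n s = trunc n t) (fun s t h => ?_) h
  have hr := root_eq_of_trunc_eq (h 1)
  have hl n := congrArg left (h (n + 1))
  have hr' n := congrArg right (h (n + 1))
  have hb n := congrArg body (h (n + 1))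
  simp only [left_trunc_succ, right_trunc_succ, body_trunc_succ] at hl hr' hb
  rcases atom_or_app_or_lam t with ht | ⟨a, b, rfl⟩ | ⟨a, rfl⟩
  · rw [eq_of_root_eq_of_isAtom ht hr]
    exact .refl _
  · rw [eq_app_of_root (s := s) (by simpa using hr)]
    exact .app (by simpa using hl) (by simpa using hr')
  · rw [eq_lam_of_root (s := s) (by simpa using hr)]
    exact .lam (by simpa using hb)

theorem dist_le_of_trunc_eq {n : ℕ} {s t : Term C} (h : trunc n s = trunc n t) :
    dist s t ≤ (2 : ℝ)⁻¹ ^ n :=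
  csInf_le ⟨0, by rintro _ ⟨m, -, rfl⟩; positivity⟩ ⟨n, h, rfl⟩

theorem trunc_eq_of_dist_lt {n : ℕ} {s t : Term C} (h : dist s t < (2 : ℝ)⁻¹ ^ n) :
    trunc n s = trunc n t := by
  obtain ⟨_, ⟨m, hm, rfl⟩, hlt⟩ := exists_lt_of_csInf_lt (by exact ⟨_, 0, rfl, rfl⟩) h
  refine trunc_eq_of_le (le_of_lt ?_) hm
  exact (pow_lt_pow_iff_right_of_lt_one₀ (by norm_num) (by norm_num)).1 hlt

/-! ### The algebra of renamings and substitutions -/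

/-- The substitution that replaces each free index by its renaming. -/
def renSub (ρ : ℕ → ℕ) : ℕ → Term C := fun n => var (ρ n)

theorem upSub_renSub (ρ : ℕ → ℕ) : upSub (renSub ρ : ℕ → Term C) = renSub (upRen ρ) := by
  funext n
  cases n <;> simp [upSub, renSub, upRen, shift]

theorem subst_renSub (ρ : ℕ → ℕ) (t : Term C) : subst (renSub ρ) t = rename ρ t := by
  refine eq_of_bisim (fun a b => ∃ ρ t, a = subst (renSub ρ) t ∧ b = rename ρ t) ?_
    ⟨ρ, t, rfl, rfl⟩
  rintro _ _ ⟨ρ, t, rfl, rfl⟩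
  induction t using shapeCases with
  | var n => simpa [renSub] using .refl _
  | bot => simpa using .refl _
  | const c => simpa using .refl _
  | app a b => simpa using .app ⟨_, _, rfl, rfl⟩ ⟨_, _, rfl, rfl⟩
  | lam a => simpa [upSub_renSub] using .lam ⟨_, _, rfl, rfl⟩

theorem upSub_var : upSub (var : ℕ → Term C) = var := by
  funext n
  cases n <;> simp [upSub, shift]

theorem subst_var_eq_self (t : Term C) : subst var t = t := by
  refine eq_of_bisim (fun a b => a = subst var b) ?_ rfl
  rintro _ t rfl
  induction t using shapeCases with
  | var n => simpa using .refl _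
  | bot => simpa using .refl _
  | const c => simpa using .refl _
  | app a b => simpa using .app rfl rfl
  | lam a => simpa [upSub_var] using .lam rfl

theorem upSub_comp_upRen (ρ : ℕ → ℕ) (τ : ℕ → Term C) :
    (fun n => upSub τ (upRen ρ n)) = upSub (fun n => τ (ρ n)) := by
  funext n
  cases n <;> simp [upSub, upRen]

theorem subst_rename (ρ : ℕ → ℕ) (τ : ℕ → Term C) (t : Term C) :
    subst τ (rename ρ t) = subst (fun n => τ (ρ n)) t := by
  refine eq_of_bisim
    (fun a b => ∃ ρ τ t, a = subst τ (rename ρ t) ∧ b = subst (fun n => τ (ρ n)) t) ?_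
    ⟨ρ, τ, t, rfl, rfl⟩
  rintro _ _ ⟨ρ, τ, t, rfl, rfl⟩
  induction t using shapeCases with
  | var n => simpa using .refl _
  | bot => simpa using .refl _
  | const c => simpa using .refl _
  | app a b => simpa using .app ⟨ρ, τ, a, rfl, rfl⟩ ⟨ρ, τ, b, rfl, rfl⟩
  | lam a =>
    simpa [← upSub_comp_upRen] using .lam ⟨upRen ρ, upSub τ, a, rfl, rfl⟩

theorem rename_rename (ρ ρ' : ℕ → ℕ) (t : Term C) :
    rename ρ' (rename ρ t) = rename (fun n => ρ' (ρ n)) t := by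
  rw [← subst_renSub ρ', subst_rename, ← subst_renSub]
  rfl

theorem rename_upRen_shift (ρ : ℕ → ℕ) (t : Term C) :
    rename (upRen ρ) (shift t) = shift (rename ρ t) := by
  rw [shift, shift, rename_rename, rename_rename]
  rfl

theorem rename_upRen_upSub (ρ : ℕ → ℕ) (σ : ℕ → Term C) :
    (fun n => rename (upRen ρ) (upSub σ n)) = upSub (fun n => rename ρ (σ n)) := by
  funext n
  cases n
  · simp [upSub, upRen]
  · simp [upSub, rename_upRen_shift]

theorem rename_subst (ρ : ℕ → ℕ) (σ : ℕ → Term C) (t : Term C) :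
    rename ρ (subst σ t) = subst (fun n => rename ρ (σ n)) t := by
  refine eq_of_bisim
    (fun a b => ∃ ρ σ t, a = rename ρ (subst σ t) ∧ b = subst (fun n => rename ρ (σ n)) t) ?_
    ⟨ρ, σ, t, rfl, rfl⟩
  rintro _ _ ⟨ρ, σ, t, rfl, rfl⟩
  induction t using shapeCases with
  | var n => simpa using .refl _
  | bot => simpa using .refl _
  | const c => simpa using .refl _
  | app a b => simpa using .app ⟨ρ, σ, a, rfl, rfl⟩ ⟨ρ, σ, b, rfl, rfl⟩
  | lam a =>
    simpa [← rename_upRen_upSub] using .lam ⟨upRen ρ, upSub σ, a, rfl, rfl⟩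

theorem subst_upSub_shift (τ : ℕ → Term C) (t : Term C) :
    subst (upSub τ) (shift t) = shift (subst τ t) := by
  rw [shift, shift, subst_rename, rename_subst]
  rfl

theorem subst_upSub_upSub (σ τ : ℕ → Term C) :
    (fun n => subst (upSub τ) (upSub σ n)) = upSub (fun n => subst τ (σ n)) := by
  funext n
  cases n
  · simp [upSub]
  · simp [upSub, subst_upSub_shift]

theorem subst_subst (σ τ : ℕ → Term C) (t : Term C) :
    subst τ (subst σ t) = subst (fun n => subst τ (σ n)) t := by
  refine eq_of_bisim
    (fun a b => ∃ σ τ t, a = subst τ (subst σ t) ∧ b = subst (fun n => subst τ (σ n)) t) ?_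
    ⟨σ, τ, t, rfl, rfl⟩
  rintro _ _ ⟨σ, τ, t, rfl, rfl⟩
  induction t using shapeCases with
  | var n => simpa using .refl _
  | bot => simpa using .refl _
  | const c => simpa using .refl _
  | app a b => simpa using .app ⟨σ, τ, a, rfl, rfl⟩ ⟨σ, τ, b, rfl, rfl⟩
  | lam a =>
    simpa [← subst_upSub_upSub] using .lam ⟨upSub σ, upSub τ, a, rfl, rfl⟩

/-- The substitution carried out by `substAt`. -/
def single (n : ℕ) (s : Term C) : ℕ → Term C :=
  fun m => if m < n then var m else if m = n then s else var (m - 1)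

theorem substAt_eq (t : Term C) (n : ℕ) (s : Term C) : t.substAt n s = subst (single n s) t := rfl

theorem upSub_single (n : ℕ) (s : Term C) :
    upSub (single n s) = single (n + 1) (shift s) := by
  funext m
  rcases m with _ | m
  · simp [upSub, single]
  · rcases lt_trichotomy m n with h | h | h
    · simp [upSub, single, h, shift]
    · simp [upSub, single, h]
    · have h1 : ¬ m < n := by omega
      have h2 : m ≠ n := by omega
      have h3 : m - 1 + 1 = m := by omega
      simp [upSub, single, h1, h2, h3, shift]

theorem subst_single_zero_shift (s t : Term C) : subst (single 0 s) (shift t) = t := by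
  rw [shift, subst_rename]
  exact subst_var_eq_self t

/-- Substitution commutes with the contraction of a `β`-redex. -/
theorem subst_substAt_zero (σ : ℕ → Term C) (s t : Term C) :
    subst σ (s.substAt 0 t) = (subst (upSub σ) s).substAt 0 (subst σ t) := by
  rw [substAt_eq, substAt_eq, subst_subst, subst_subst]
  congr 1
  funext n
  rcases n with _ | n
  · simp [single, upSub]
  · simp [single, upSub, subst_single_zero_shift]

end Term
end InfLambda

namespace InfLambda
open Term Relation
variable {C : Type u}

/-! ### The infinitary closure -/

theorem InfRule.mono {r X Y : Term C → Term C → Prop} (h : ∀ s t, X s t → Y s t) {s t : Term C} :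
    InfRule r X s t → InfRule r Y s t
  | .atom ha hs => .atom ha hs
  | .app hs h₁ h₂ => .app hs (h _ _ h₁) (h _ _ h₂)
  | .lam hs h₁ => .lam hs (h _ _ h₁)

theorem InfRule.prepend {r X : Term C → Term C → Prop} {s s' t : Term C}
    (h : ReflTransGen r s s') : InfRule r X s' t → InfRule r X s t
  | .atom ha hs => .atom ha (h.trans hs)
  | .app hs h₁ h₂ => .app (h.trans hs) h₁ h₂
  | .lam hs h₁ => .lam (h.trans hs) h₁

theorem InfClosure.dest {r : Term C → Term C → Prop} {s t : Term C} (h : InfClosure r s t) :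
    InfRule r (InfClosure r) s t := by
  obtain ⟨X, hX, h⟩ := h
  exact (hX _ _ h).mono fun _ _ h => ⟨X, hX, h⟩

/-- Coinduction up to `InfClosure r`: premises may also be found in the closure itself. -/
theorem InfClosure.coind {r : Term C → Term C → Prop} (X : Term C → Term C → Prop)
    (hX : ∀ s t, X s t → InfRule r (fun a b => InfClosure r a b ∨ X a b) s t)
    {s t : Term C} (h : X s t) : InfClosure r s t := by
  refine ⟨fun a b => InfClosure r a b ∨ X a b, ?_, .inr h⟩
  rintro s t (h | h)
  · exact h.dest.mono fun _ _ h => .inl h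
  · exact hX _ _ h

theorem InfClosure.of_rule {r : Term C → Term C → Prop} {s t : Term C}
    (h : InfRule r (InfClosure r) s t) : InfClosure r s t :=
  .coind (InfRule r (InfClosure r)) (fun _ _ h => h.mono fun _ _ h => .inl h) h

theorem InfClosure.prepend {r : Term C → Term C → Prop} {s s' t : Term C}
    (h : ReflTransGen r s s') (h' : InfClosure r s' t) : InfClosure r s t :=
  .of_rule (h'.dest.prepend h)

theorem InfClosure.refl (r : Term C → Term C → Prop) (t : Term C) : InfClosure r t t := by
  refine .coind (fun a b => a = b) ?_ rfl
  rintro t _ rfl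
  rcases atom_or_app_or_lam t with h | ⟨a, b, rfl⟩ | ⟨a, rfl⟩
  · exact .atom h .refl
  · exact .app .refl (.inr rfl) (.inr rfl)
  · exact .lam .refl (.inr rfl)

theorem InfClosure.of_reflTransGen {r : Term C → Term C → Prop} {s t : Term C}
    (h : ReflTransGen r s t) : InfClosure r s t := (InfClosure.refl r t).prepend h

theorem InfClosure.app_dest {r : Term C → Term C → Prop} {s a b : Term C}
    (h : InfClosure r s (app a b)) :
    ∃ p q, ReflTransGen r s (app p q) ∧ InfClosure r p a ∧ InfClosure r q b := by
  generalize he : app a b = t at h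
  rcases h.dest with ⟨ha, -⟩ | ⟨hs, h₁, h₂⟩ | ⟨hs, h₁⟩
  · simp [← he] at ha
  · obtain ⟨rfl, rfl⟩ := app_inj.1 he
    exact ⟨_, _, hs, h₁, h₂⟩
  · simp at he

theorem InfClosure.lam_dest {r : Term C → Term C → Prop} {s a : Term C}
    (h : InfClosure r s (lam a)) : ∃ p, ReflTransGen r s (lam p) ∧ InfClosure r p a := by
  generalize he : lam a = t at h
  rcases h.dest with ⟨ha, -⟩ | ⟨hs, h₁, h₂⟩ | ⟨hs, h₁⟩
  · simp [← he] at ha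
  · simp at he
  · obtain rfl := lam_inj.1 he
    exact ⟨_, hs, h₁⟩

theorem InfClosure.atom_dest {r : Term C → Term C → Prop} {s a : Term C} (ha : IsAtom a)
    (h : InfClosure r s a) : ReflTransGen r s a := by
  rcases h.dest with ⟨-, hs⟩ | ⟨hs, h₁, h₂⟩ | ⟨hs, h₁⟩
  · exact hs
  · simp at ha
  · simp at ha

theorem reflTransGen_compat_appL {R : Term C → Term C → Prop} {s s' : Term C} (t : Term C)
    (h : ReflTransGen (Compat R) s s') : ReflTransGen (Compat R) (app s t) (app s' t) :=
  h.lift (fun x => app x t) fun _ _ h => .appL h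

theorem reflTransGen_compat_appR {R : Term C → Term C → Prop} (s : Term C) {t t' : Term C}
    (h : ReflTransGen (Compat R) t t') : ReflTransGen (Compat R) (app s t) (app s t') :=
  h.lift (fun x => app s x) fun _ _ h => .appR h

theorem reflTransGen_compat_lam {R : Term C → Term C → Prop} {s s' : Term C}
    (h : ReflTransGen (Compat R) s s') : ReflTransGen (Compat R) (lam s) (lam s') :=
  h.lift lam fun _ _ h => .lam h

/-! ### From the infinitary closure to reduction sequences of length at most `ω` -/

theorem StepAt.trunc_eq {R : Term C → Term C → Prop} {d : ℕ} {s t : Term C} (h : StepAt R d s t)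
    {n : ℕ} (hn : n ≤ d) : trunc n s = trunc n t := by
  induction h generalizing n with
  | base h => obtain rfl : n = 0 := by omega
              rfl
  | appL _ ih | appR _ ih | lam _ ih =>
    cases n with
    | zero => rfl
    | succ n => simp [ih (Nat.le_of_succ_le_succ hn)]

/-- `PathGe R n k s t`: there are `k` successive steps from `s` to `t`, all contracting redexes
at depth at least `n`. -/
inductive PathGe (R : Term C → Term C → Prop) (n : ℕ) : ℕ → Term C → Term C → Prop
  | nil (s) : PathGe R n 0 s s
  | cons {d k s s' t} : n ≤ d → StepAt R d s s' → PathGe R n k s' t → PathGe R n (k + 1) s t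

namespace PathGe

variable {R : Term C → Term C → Prop} {n k k' : ℕ} {s s' t t' u : Term C}

theorem trans (h : PathGe R n k s t) (h' : PathGe R n k' t u) : ∃ l, PathGe R n l s u := by
  induction h with
  | nil => exact ⟨_, h'⟩
  | cons hd hs _ ih =>
    obtain ⟨l, hl⟩ := ih h'
    exact ⟨_, .cons hd hs hl⟩

theorem appL (h : PathGe R n k s s') : PathGe R (n + 1) k (app s t) (app s' t) := by
  induction h with
  | nil => exact .nil _
  | cons hd hs _ ih => exact .cons (Nat.succ_le_succ hd) hs.appL ih

theorem appR (h : PathGe R n k t t') : PathGe R (n + 1) k (app s t) (app s t') := by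
  induction h with
  | nil => exact .nil _
  | cons hd hs _ ih => exact .cons (Nat.succ_le_succ hd) hs.appR ih

theorem lam (h : PathGe R n k s s') : PathGe R (n + 1) k (lam s) (lam s') := by
  induction h with
  | nil => exact .nil _
  | cons hd hs _ ih => exact .cons (Nat.succ_le_succ hd) hs.lam ih

theorem trunc_eq (h : PathGe R n k s t) : trunc n s = trunc n t := by
  induction h with
  | nil => rfl
  | cons hd hs _ ih => exact (hs.trunc_eq hd).trans ih

theorem of_reflTransGen (h : ReflTransGen (Compat R) s t) : ∃ k, PathGe R 0 k s t := by
  induction h using ReflTransGen.head_induction_on with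
  | refl => exact ⟨0, .nil _⟩
  | head h _ ih =>
    obtain ⟨d, hd⟩ := compat_iff_exists_stepAt.1 h
    obtain ⟨k, hk⟩ := ih
    exact ⟨k + 1, .cons (Nat.zero_le d) hd hk⟩

end PathGe

/-- `InfBelow r n s t`: the terms `s` and `t` agree above depth `n`, and each subterm of `s` at
depth `n` is related by `InfClosure r` to the subterm of `t` at the same position. -/
def InfBelow (r : Term C → Term C → Prop) : ℕ → Term C → Term C → Prop
  | 0, s, t => InfClosure r s t
  | n + 1, s, t => (IsAtom s ∧ s = t) ∨
      (∃ a b a' b', s = app a b ∧ t = app a' b' ∧ InfBelow r n a a' ∧ InfBelow r n b b') ∨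
      ∃ a a', s = lam a ∧ t = lam a' ∧ InfBelow r n a a'

theorem InfBelow.trunc_eq {r : Term C → Term C → Prop} {n : ℕ} {s t : Term C}
    (h : InfBelow r n s t) : trunc n s = trunc n t := by
  induction n generalizing s t with
  | zero => rfl
  | succ n ih =>
    rcases h with ⟨-, rfl⟩ | ⟨a, b, a', b', rfl, rfl, h₁, h₂⟩ | ⟨a, a', rfl, rfl, h⟩
    · rfl
    · simp [ih h₁, ih h₂]
    · simp [ih h]

/-- Finitely many steps at depth at least `n` gain one level of agreement: each subterm at depth
`n` needs a finite reduction, and there are finitely many of them. -/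
theorem InfBelow.next {R : Term C → Term C → Prop} {n : ℕ} {s t : Term C}
    (h : InfBelow (Compat R) n s t) :
    ∃ k s', PathGe R n k s s' ∧ InfBelow (Compat R) (n + 1) s' t := by
  induction n generalizing s t with
  | zero =>
    rcases InfClosure.dest h with ⟨ha, hs⟩ | ⟨hs, h₁, h₂⟩ | ⟨hs, h₁⟩
    · obtain ⟨k, hk⟩ := PathGe.of_reflTransGen hs
      exact ⟨k, _, hk, .inl ⟨ha, rfl⟩⟩
    · obtain ⟨k, hk⟩ := PathGe.of_reflTransGen hs
      exact ⟨k, _, hk, .inr (.inl ⟨_, _, _, _, rfl, rfl, h₁, h₂⟩)⟩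
    · obtain ⟨k, hk⟩ := PathGe.of_reflTransGen hs
      exact ⟨k, _, hk, .inr (.inr ⟨_, _, rfl, rfl, h₁⟩)⟩
  | succ n ih =>
    rcases h with ⟨ha, rfl⟩ | ⟨a, b, a', b', rfl, rfl, h₁, h₂⟩ | ⟨a, a', rfl, rfl, h⟩
    · exact ⟨0, s, .nil _, .inl ⟨ha, rfl⟩⟩
    · obtain ⟨k₁, s₁, hk₁, hs₁⟩ := ih h₁
      obtain ⟨k₂, s₂, hk₂, hs₂⟩ := ih h₂
      obtain ⟨k, hk⟩ := (hk₁.appL (t := b)).trans (hk₂.appR (s := s₁))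
      exact ⟨k, _, hk, .inr (.inl ⟨_, _, _, _, rfl, rfl, hs₁, hs₂⟩)⟩
    · obtain ⟨k, s', hk, hs⟩ := ih h
      exact ⟨k, _, hk.lam, .inr (.inr ⟨_, _, rfl, rfl, hs⟩)⟩

/-- A stage of the level-by-level construction of a reduction to `t`: from the current term
`term`, another `fuel` steps at depth at least `level` lead to a term that agrees with `t` above
depth `level + 1` and still reduces to `t` below. -/
structure Stage (R : Term C → Term C → Prop) (t : Term C) where
  level : ℕ
  fuel : ℕ
  term : Term C
  spec : ∃ y, PathGe R level fuel term y ∧ InfBelow (Compat R) (level + 1) y t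

namespace Stage

variable {R : Term C → Term C → Prop} {t : Term C}

theorem trunc_eq (x : Stage R t) : trunc x.level x.term = trunc x.level t := by
  obtain ⟨y, hy, hy'⟩ := x.spec
  exact hy.trunc_eq.trans (trunc_eq_of_le (Nat.le_succ _) hy'.trunc_eq)

/-- The relation between a stage and the stage after the next step of the reduction to `t`. -/
def Next (x x' : Stage R t) : Prop :=
  (∃ d, x'.level ≤ d ∧ StepAt R d x.term x'.term) ∧
    (x.level < x'.level ∨ x.level = x'.level ∧ x'.fuel < x.fuel)

theorem exists_next (x : Stage R t) (h : x.term ≠ t) : ∃ x', Next x x' := by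
  obtain ⟨m, hm⟩ : ∃ m, trunc m x.term ≠ trunc m t := by
    by_contra! hc
    exact h (eq_of_trunc_eq hc)
  -- Levels at which no step is left are skipped; the witness `m` bounds their number.
  obtain ⟨j, hj⟩ : ∃ j, m ≤ x.level + j := ⟨m, by omega⟩
  obtain ⟨n, k, s, y, hk, hy⟩ := x
  dsimp only at h hm hj
  induction j generalizing n k y with
  | zero => exact absurd (trunc_eq_of_le hj (trunc_eq ⟨n, k, s, y, hk, hy⟩)) hm
  | succ j ih =>
    cases hk with
    | nil =>
      obtain ⟨k', y', hk', hy'⟩ := hy.next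
      obtain ⟨x', ⟨h₁, h₂⟩⟩ := ih (n + 1) k' y' hk' hy' (by omega)
      refine ⟨x', h₁, .inl ?_⟩
      rcases h₂ with h₂ | ⟨h₂, -⟩ <;> dsimp only at h₂ ⊢ <;> omega
    | cons hd hs hk => exact ⟨⟨n, _, _, y, hk, hy⟩, ⟨_, hd, hs⟩, .inr ⟨rfl, Nat.lt_succ_self _⟩⟩

end Stage

open Classical in
/-- The sequence of stages obtained by following `Stage.Next` as long as `t` is not reached. -/
noncomputable def stages {R : Term C → Term C → Prop} {t : Term C} (x : Stage R t) :
    ℕ → Stage R t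
  | 0 => x
  | i + 1 => if h : (stages x i).term ≠ t then ((stages x i).exists_next h).choose else stages x i

theorem stages_next {R : Term C → Term C → Prop} {t : Term C} (x : Stage R t) {i : ℕ}
    (h : (stages x i).term ≠ t) : (stages x i).Next (stages x (i + 1)) := by
  rw [stages, dif_pos h]
  exact ((stages x i).exists_next h).choose_spec

theorem stages_level_mono {R : Term C → Term C → Prop} {t : Term C} (x : Stage R t) :
    Monotone fun i => (stages x i).level := by
  refine monotone_nat_of_le_succ fun i => ?_
  by_cases h : (stages x i).term ≠ t
  · rcases (stages_next x h).2 with h | h <;> omega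
  · rw [stages, dif_neg h]

/-- The levels tend to infinity, as the fuel decreases as long as the level is constant. -/
theorem exists_stages_level_ge {R : Term C → Term C → Prop} {t : Term C} (x : Stage R t)
    (h : ∀ i, (stages x i).term ≠ t) (d : ℕ) : ∃ i, d ≤ (stages x i).level := by
  induction d with
  | zero => exact ⟨0, Nat.zero_le _⟩
  | succ d ih =>
    obtain ⟨i, hi⟩ := ih
    induction hk : (stages x i).fuel using Nat.strong_induction_on generalizing i with
    | _ k ih =>
      rcases (stages_next x (h i)).2 with h' | ⟨h', hf⟩
      · exact ⟨i + 1, by omega⟩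
      · exact ih _ (hk ▸ hf) (i + 1) (by omega) rfl

/-- A sequence of steps indexed by natural numbers, as the values of a function of ordinals. -/
theorem strongConvSeq_of_nat {R : Term C → Term C → Prop} {t : Term C} (f : ℕ → Term C) (N : ℕ)
    (h : ∀ i < N, ∃ d, StepAt R d (f i) (f (i + 1))) (ht : f N = t) :
    Nonempty (StrongConvSeq R (N : Ordinal.{v}) (f 0) t) := by
  choose! d hd using h
  have hlim : ∀ δ ≤ (N : Ordinal.{v}), ¬ Order.IsSuccLimit δ := fun δ hδ hl =>
    absurd (Ordinal.omega0_le_of_isSuccLimit hl)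
      (not_le.2 (hδ.trans_lt (Ordinal.natCast_lt_omega0 N)))
  refine ⟨⟨fun γ => f (Cardinal.toNat γ.card), fun γ => d (Cardinal.toNat γ.card), by simp,
    by simpa using ht, fun γ hγ => ?_, fun δ hδ hl => absurd hl (hlim δ hδ),
    fun δ hδ hl => absurd hl (hlim δ hδ)⟩⟩
  obtain ⟨n, rfl⟩ := Ordinal.lt_omega0.1 (hγ.trans (Ordinal.natCast_lt_omega0 N))
  have := hd n (by exact_mod_cast hγ)
  rw [show ((n : Ordinal.{v}) + 1) = ((n + 1 : ℕ) : Ordinal.{v}) by simp]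
  simpa only [Ordinal.card_nat, Cardinal.toNat_natCast] using this

theorem strongConvSeq_omega {R : Term C → Term C → Prop} {t : Term C} (f : ℕ → Term C)
    (d : ℕ → ℕ) (h : ∀ i, StepAt R (d i) (f i) (f (i + 1)))
    (hd : ∀ k, ∃ i, ∀ j ≥ i, k < d j ∧ trunc k (f j) = trunc k t) :
    Nonempty (StrongConvSeq R Ordinal.omega0.{v} (f 0) t) := by
  have hω : ∀ δ ≤ Ordinal.omega0.{v}, Order.IsSuccLimit δ → δ = Ordinal.omega0 :=
    fun δ hδ hl => le_antisymm hδ (Ordinal.omega0_le_of_isSuccLimit hl)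
  have hval : ∀ (γ : Ordinal.{v}), γ < Ordinal.omega0 → ∃ n : ℕ, γ = n ∧
      (if γ < Ordinal.omega0 then f (Cardinal.toNat γ.card) else t) = f n := by
    intro γ hγ
    obtain ⟨n, rfl⟩ := Ordinal.lt_omega0.1 hγ
    exact ⟨n, rfl, by rw [if_pos hγ]; simp⟩
  refine ⟨⟨fun γ => if γ < Ordinal.omega0 then f (Cardinal.toNat γ.card) else t,
    fun γ => d (Cardinal.toNat γ.card), by simp [Ordinal.omega0_pos], by simp, ?_, ?_, ?_⟩⟩
  · intro γ hγ
    obtain ⟨n, rfl⟩ := Ordinal.lt_omega0.1 hγ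
    have hn : (n : Ordinal.{v}) + 1 = ((n + 1 : ℕ) : Ordinal.{v}) := by simp
    rw [if_pos hγ, hn, if_pos (Ordinal.natCast_lt_omega0 _)]
    simpa only [Ordinal.card_nat, Cardinal.toNat_natCast] using h n
  · intro δ hδ hl ε hε
    obtain rfl := hω δ hδ hl
    obtain ⟨k, hk⟩ := exists_pow_lt_of_lt_one hε (show (2 : ℝ)⁻¹ < 1 by norm_num)
    obtain ⟨i, hi⟩ := hd k
    refine ⟨i, Ordinal.natCast_lt_omega0 i, fun γ h₁ h₂ => ?_⟩
    obtain ⟨n, rfl, hn⟩ := hval γ h₂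
    rw [hn, if_neg (lt_irrefl _)]
    exact (dist_le_of_trunc_eq (hi n (by exact_mod_cast h₁)).2).trans_lt hk
  · intro δ hδ hl k
    obtain rfl := hω δ hδ hl
    obtain ⟨i, hi⟩ := hd k
    refine ⟨i, Ordinal.natCast_lt_omega0 i, fun γ h₁ h₂ => ?_⟩
    obtain ⟨n, rfl, -⟩ := hval γ h₂
    simpa using (hi n (by exact_mod_cast h₁)).1

theorem InfClosure.exists_strongConvSeq {R : Term C → Term C → Prop} {s t : Term C}
    (h : InfClosure (Compat R) s t) :
    ∃ ξ : Ordinal.{v}, ξ ≤ Ordinal.omega0 ∧ Nonempty (StrongConvSeq R ξ s t) := by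
  classical
  obtain ⟨k, y, hk, hy⟩ := InfBelow.next (n := 0) h
  let x : Stage R t := ⟨0, k, s, y, hk, hy⟩
  by_cases hfin : ∃ i, (stages x i).term = t
  · refine ⟨(Nat.find hfin : ℕ), (Ordinal.natCast_lt_omega0 _).le,
      strongConvSeq_of_nat (fun i => (stages x i).term) _ (fun i hi => ?_) (Nat.find_spec hfin)⟩
    obtain ⟨⟨d, -, hd⟩, -⟩ := stages_next x (Nat.find_min hfin hi)
    exact ⟨d, hd⟩
  · push Not at hfin
    choose d hd hstep using fun i => (stages_next x (hfin i)).1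
    refine ⟨_, le_rfl, strongConvSeq_omega (fun i => (stages x i).term) d hstep fun k => ?_⟩
    obtain ⟨i, hi⟩ := exists_stages_level_ge x hfin (k + 1)
    refine ⟨i, fun j hj => ?_⟩
    have h₁ : (stages x i).level ≤ (stages x j).level := stages_level_mono x hj
    have h₂ : (stages x j).level ≤ (stages x (j + 1)).level := stages_level_mono x (Nat.le_succ j)
    have h₃ := hd j
    exact ⟨by omega, trunc_eq_of_le (by omega) (stages x j).trunc_eq⟩

/-! ### From reduction sequences to the infinitary closure -/

/-- Equality, or a step that contracts a redex at depth at least `n`. -/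
def StepGe (R : Term C → Term C → Prop) (n : ℕ) (s t : Term C) : Prop :=
  s = t ∨ ∃ d, n ≤ d ∧ StepAt R d s t

/-- The part between the indices `α` and `β` of a strongly convergent sequence in which terms may
be repeated. Unlike in `StrongConvSeq`, the sequence is not reindexed to start at `0`. Both
choices make the notion stable under taking final segments and immediate subterms. -/
structure WeakSeq (R : Term C → Term C → Prop) (α β : Ordinal.{v}) (f : Ordinal.{v} → Term C) :
    Prop where
  step : ∀ γ, α ≤ γ → γ < β → StepGe R 0 (f γ) (f (γ + 1))
  limit : ∀ δ, α < δ → δ ≤ β → Order.IsSuccLimit δ → ∀ n, ∃ γ, α ≤ γ ∧ γ < δ ∧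
    ∀ γ', γ ≤ γ' → γ' < δ → trunc n (f γ') = trunc n (f δ) ∧ StepGe R n (f γ') (f (γ' + 1))

theorem StrongConvSeq.weakSeq {R : Term C → Term C → Prop} {ζ : Ordinal.{v}} {s t : Term C}
    (S : StrongConvSeq R ζ s t) : WeakSeq R 0 ζ S.f where
  step γ _ hγ := .inr ⟨_, Nat.zero_le _, S.step γ hγ⟩
  limit δ _ hδ hl n := by
    obtain ⟨γ₁, h₁, h₁'⟩ := S.tendsto_limit δ hδ hl ((2 : ℝ)⁻¹ ^ n) (by positivity)
    obtain ⟨γ₂, h₂, h₂'⟩ := S.depth_limit δ hδ hl n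
    refine ⟨max γ₁ γ₂, zero_le, max_lt h₁ h₂, fun γ' h h' => ⟨?_, .inr ⟨_, ?_, S.step γ' ?_⟩⟩⟩
    · exact trunc_eq_of_dist_lt (h₁' γ' ((le_max_left _ _).trans h) h')
    · exact (h₂' γ' ((le_max_right _ _).trans h) h').le
    · exact h'.trans_le hδ

theorem StepGe.left {R : Term C → Term C → Prop} {n : ℕ} {s t : Term C}
    (h : StepGe R (n + 1) s t) : StepGe R n (left s) (left t) := by
  rcases h with rfl | ⟨_, hd, h⟩
  · exact .inl rfl
  · cases h with
    | base h => omega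
    | appL h => exact .inr ⟨_, Nat.le_of_succ_le_succ hd, by simpa using h⟩
    | appR h => exact .inl (by simp)
    | lam h => exact .inl (by simp)

theorem StepGe.right {R : Term C → Term C → Prop} {n : ℕ} {s t : Term C}
    (h : StepGe R (n + 1) s t) : StepGe R n (right s) (right t) := by
  rcases h with rfl | ⟨_, hd, h⟩
  · exact .inl rfl
  · cases h with
    | base h => omega
    | appL h => exact .inl (by simp)
    | appR h => exact .inr ⟨_, Nat.le_of_succ_le_succ hd, by simpa using h⟩
    | lam h => exact .inl (by simp)

theorem StepGe.body {R : Term C → Term C → Prop} {n : ℕ} {s t : Term C}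
    (h : StepGe R (n + 1) s t) : StepGe R n (body s) (body t) := by
  rcases h with rfl | ⟨_, hd, h⟩
  · exact .inl rfl
  · cases h with
    | base h => omega
    | appL h => exact .inl (by simp)
    | appR h => exact .inl (by simp)
    | lam h => exact .inr ⟨_, Nat.le_of_succ_le_succ hd, by simpa using h⟩

namespace WeakSeq

variable {R : Term C → Term C → Prop} {α α' β β' : Ordinal.{v}} {f : Ordinal.{v} → Term C}

theorem mono (h : WeakSeq R α β f) (hα : α ≤ α') (hβ : β' ≤ β) : WeakSeq R α' β' f where
  step γ h₁ h₂ := h.step γ (hα.trans h₁) (h₂.trans_le hβ)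
  limit δ h₁ h₂ hl n := by
    obtain ⟨γ, hγ, hγ', hlim⟩ := h.limit δ (hα.trans_lt h₁) (h₂.trans hβ) hl n
    exact ⟨max α' γ, le_max_left _ _, max_lt h₁ hγ', fun γ' h h' =>
      hlim γ' ((le_max_right _ _).trans h) h'⟩

/-- Taking an immediate subterm (`g` being `left`, `right` or `body`) of all terms of a sequence
without steps at the root. -/
theorem map {g : Term C → Term C}
    (hg : ∀ n s t, StepGe R (n + 1) s t → StepGe R n (g s) (g t))
    (hg' : ∀ n t, g (trunc (n + 1) t) = trunc n (g t))
    (h : WeakSeq R α β f) (h' : ∀ γ, α ≤ γ → γ < β → StepGe R 1 (f γ) (f (γ + 1))) :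
    WeakSeq R α β fun γ => g (f γ) where
  step γ h₁ h₂ := hg _ _ _ (h' γ h₁ h₂)
  limit δ h₁ h₂ hl n := by
    obtain ⟨γ, hγ, hγ', hlim⟩ := h.limit δ h₁ h₂ hl (n + 1)
    refine ⟨γ, hγ, hγ', fun γ' h h' => ⟨?_, hg _ _ _ (hlim γ' h h').2⟩⟩
    rw [← hg', ← hg', (hlim γ' h h').1]

/-- If finite reductions can be appended to infinitary ones, then so can strongly convergent
ones. At a limit ordinal, the steps beyond some index are not at the root; up to this index the
induction hypothesis applies, and beyond it the sequences of immediate subterms, which end at the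
same ordinal, are dealt with by coinduction. -/
theorem infClosure (hR : Appendable (Compat R)) (h : WeakSeq R α β f) (hαβ : α ≤ β) {s : Term C}
    (hs : InfClosure (Compat R) s (f α)) : InfClosure (Compat R) s (f β) := by
  induction β using WellFoundedLT.induction generalizing α f s with
  | ind β ih =>
    rcases hαβ.eq_or_lt with rfl | hlt
    · exact hs
    rcases Ordinal.zero_or_succ_or_isSuccLimit β with rfl | ⟨γ, rfl⟩ | hl
    · exact absurd hlt (not_lt.2 zero_le)
    · have hγ : γ < Order.succ γ := Order.lt_succ γ
      have hαγ : α ≤ γ := Order.lt_succ_iff.1 hlt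
      have := ih γ hγ (h.mono le_rfl hγ.le) hαγ hs
      rw [Order.succ_eq_add_one]
      rcases h.step γ hαγ hγ with he | ⟨d, -, hd⟩
      · exact he ▸ this
      · exact hR _ _ _ this (compat_iff_exists_stepAt.2 ⟨d, hd⟩)
    · refine InfClosure.coind (fun a b => ∃ α f, α < β ∧ WeakSeq R α β f ∧
        InfClosure (Compat R) a (f α) ∧ b = f β) ?_ ⟨α, f, hlt, h, hs, rfl⟩
      rintro s _ ⟨α, f, hlt, h, hs, rfl⟩
      obtain ⟨γ, hαγ, hγβ, hγ⟩ := h.limit β hlt le_rfl hl 1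
      have hsγ := ih γ hγβ (h.mono le_rfl hγβ.le) hαγ hs
      have hroot : root (f γ) = root (f β) := root_eq_of_trunc_eq (hγ γ le_rfl hγβ).1
      have htail := h.mono hαγ le_rfl
      have hdeep := fun γ' h₁ h₂ => (hγ γ' h₁ h₂).2
      rcases atom_or_app_or_lam (f β) with ha | ⟨a, b, hab⟩ | ⟨a, hab⟩
      · rw [eq_of_root_eq_of_isAtom ha hroot] at hsγ
        exact .atom ha (hsγ.atom_dest ha)
      · have hγa := eq_app_of_root (s := f γ) (by simpa [hab] using hroot)
        rw [hγa] at hsγ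
        obtain ⟨p, q, hpq, hp, hq⟩ := hsγ.app_dest
        rw [eq_app_of_root (s := f β) (by simp [hab])]
        exact .app hpq
          (.inr ⟨γ, _, hγβ, htail.map (fun _ _ _ => StepGe.left) left_trunc_succ hdeep, hp, rfl⟩)
          (.inr ⟨γ, _, hγβ, htail.map (fun _ _ _ => StepGe.right) right_trunc_succ hdeep, hq, rfl⟩)
      · have hγa := eq_lam_of_root (s := f γ) (by simpa [hab] using hroot)
        rw [hγa] at hsγ
        obtain ⟨p, hpq, hp⟩ := hsγ.lam_dest
        rw [eq_lam_of_root (s := f β) (by simp [hab])]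
        exact .lam hpq
          (.inr ⟨γ, _, hγβ, htail.map (fun _ _ _ => StepGe.body) body_trunc_succ hdeep, hp, rfl⟩)

end WeakSeq

theorem StrongConvSeq.infClosure {R : Term C → Term C → Prop} (hR : Appendable (Compat R))
    {ζ : Ordinal.{v}} {s t : Term C} (S : StrongConvSeq R ζ s t) : InfClosure (Compat R) s t := by
  have := S.weakSeq.infClosure hR zero_le (s := s) (by rw [S.f_zero]; exact .refl _ _)
  rwa [S.f_last] at this

end InfLambda

namespace InfLambda
open Term Relation
variable {C : Type u}

/-! ### Infinitary reduction and substitution -/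

/-- If single steps are preserved by a family of pairs of substitutions that is closed under
passing below a binder, and each pair is related pointwise, then infinitary reduction is
preserved. -/
theorem InfClosure.subst {r : Term C → Term C → Prop}
    (S : (ℕ → Term C) → (ℕ → Term C) → Prop) (hup : ∀ σ τ, S σ τ → S (upSub σ) (upSub τ))
    (hpt : ∀ σ τ, S σ τ → ∀ n, InfClosure r (σ n) (τ n))
    (hr : ∀ σ τ, S σ τ → ∀ s t, r s t → ReflTransGen r (s.subst σ) (t.subst σ))
    {σ τ : ℕ → Term C} (hS : S σ τ) {s t : Term C} (h : InfClosure r s t) :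
    InfClosure r (s.subst σ) (t.subst τ) := by
  refine .coind (fun a b => ∃ σ τ s t, S σ τ ∧ InfClosure r s t ∧ a = s.subst σ ∧ b = t.subst τ) ?_
    ⟨σ, τ, s, t, hS, h, rfl, rfl⟩
  rintro _ _ ⟨σ, τ, s, t, hS, h, rfl, rfl⟩
  have hr' : ∀ {s t}, ReflTransGen r s t → ReflTransGen r (s.subst σ) (t.subst σ) := fun h =>
    h.lift' (Term.subst σ) (hr σ τ hS)
  induction t using shapeCases with
  | var n =>
    have h₁ := hr' (h.atom_dest (isAtom_var n))
    rw [subst_var] at h₁ ⊢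
    exact ((hpt σ τ hS n).prepend h₁).dest.mono fun _ _ h => .inl h
  | bot =>
    have h₁ := hr' (h.atom_dest isAtom_bot)
    rw [subst_bot] at h₁ ⊢
    exact .atom isAtom_bot h₁
  | const c =>
    have h₁ := hr' (h.atom_dest (isAtom_const c))
    rw [subst_const] at h₁ ⊢
    exact .atom (isAtom_const c) h₁
  | app a b =>
    obtain ⟨p, q, hs, hp, hq⟩ := h.app_dest
    have h₁ := hr' hs
    rw [subst_app] at h₁ ⊢
    exact .app h₁ (.inr ⟨σ, τ, p, a, hS, hp, rfl, rfl⟩) (.inr ⟨σ, τ, q, b, hS, hq, rfl, rfl⟩)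
  | lam a =>
    obtain ⟨p, hs, hp⟩ := h.lam_dest
    have h₁ := hr' hs
    rw [subst_lam] at h₁ ⊢
    exact .lam h₁ (.inr ⟨_, _, p, a, hup _ _ hS, hp, rfl, rfl⟩)

/-- The substitutions that arise, below binders, from shifts and from the contraction of
`β`-redexes: insertion of a fresh index, and elimination of an index. -/
inductive BasicSub : (ℕ → Term C) → Prop
  | fresh (k : ℕ) : BasicSub (renSub (upRen^[k] Nat.succ))
  | single (n : ℕ) (s : Term C) : BasicSub (single n s)

theorem BasicSub.upSub {σ : ℕ → Term C} (h : BasicSub σ) : BasicSub (Term.upSub σ) := by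
  cases h with
  | fresh k =>
    rw [upSub_renSub, ← Function.iterate_succ_apply' upRen]
    exact .fresh _
  | single n s => rw [upSub_single]; exact .single _ _

/-- A step may be simulated by several or no steps: a subterm contracted to `bot` can itself be
`bot` after the substitution. -/
theorem Compat.subst_of_rule {R : Term C → Term C → Prop}
    (hR : ∀ σ, BasicSub σ → ∀ s t, R s t → ReflTransGen (Compat R) (s.subst σ) (t.subst σ))
    {s t : Term C} (h : Compat R s t) {σ : ℕ → Term C} (hσ : BasicSub σ) :
    ReflTransGen (Compat R) (s.subst σ) (t.subst σ) := by
  induction h generalizing σ with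
  | base h => exact hR σ hσ _ _ h
  | appL _ ih => simpa using reflTransGen_compat_appL _ (ih hσ)
  | appR _ ih => simpa using reflTransGen_compat_appR _ (ih hσ)
  | lam _ ih => simpa using reflTransGen_compat_lam (ih hσ.upSub)

/-- Infinitary reduction of the body and of the argument of a `β`-redex carries over to the
contractum. Closure under shifts comes first, because the substituted terms are shifted at each
binder. -/
theorem InfClosure.substAt_zero {r : Term C → Term C → Prop}
    (hr : ∀ σ, BasicSub σ → ∀ s t, r s t → ReflTransGen r (s.subst σ) (t.subst σ))
    {s s' t t' : Term C} (hs : InfClosure r s s') (ht : InfClosure r t t') :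
    InfClosure r (s.substAt 0 t) (s'.substAt 0 t') := by
  have hshift : ∀ {a b}, InfClosure r a b → InfClosure r (shift a) (shift b) := by
    intro a b hab
    have := InfClosure.subst (fun σ τ => σ = τ ∧ ∃ k, σ = renSub (upRen^[k] Nat.succ))
      (by
        rintro σ _ ⟨rfl, k, rfl⟩
        refine ⟨rfl, k + 1, ?_⟩
        rw [upSub_renSub, ← Function.iterate_succ_apply' upRen])
      (by rintro σ _ ⟨rfl, -⟩ n; exact .refl _ _)
      (by rintro σ _ ⟨rfl, k, rfl⟩; exact hr _ (.fresh k))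
      ⟨rfl, 0, rfl⟩ hab
    simpa [subst_renSub, shift] using this
  refine InfClosure.subst (fun σ τ => ∃ n a b, InfClosure r a b ∧ σ = single n a ∧ τ = single n b)
    ?_ ?_ ?_ ⟨0, t, t', ht, rfl, rfl⟩ hs
  · rintro _ _ ⟨n, a, b, hab, rfl, rfl⟩
    exact ⟨n + 1, _, _, hshift hab, upSub_single _ _, upSub_single _ _⟩
  · rintro _ _ ⟨n, a, b, hab, rfl, rfl⟩ m
    unfold single
    split_ifs
    exacts [.refl _ _, hab, .refl _ _]
  · rintro _ _ ⟨n, a, b, -, rfl, rfl⟩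
    exact hr _ (.single n a)

/-! ### Appending a step -/

/-- For rules that contain `β`, preserve substitution, and whose other root steps can be appended,
all steps can be appended. -/
theorem appendable_of_rule {R : Term C → Term C → Prop}
    (hβ : ∀ s t, BetaRule s t → R s t)
    (hsub : ∀ σ, BasicSub σ → ∀ s t, R s t → ReflTransGen (Compat R) (s.subst σ) (t.subst σ))
    (hroot : ∀ t₁ t₂ t₃, InfClosure (Compat R) t₁ t₂ → R t₂ t₃ →
      BetaRule t₂ t₃ ∨ InfClosure (Compat R) t₁ t₃) :
    Appendable (Compat R) := by
  intro t₁ t₂ t₃ h hstep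
  induction hstep generalizing t₁ with
  | base hR =>
    rcases hroot _ _ _ h hR with hb | h'
    · cases hb with
      | mk a b =>
        obtain ⟨p, q, hpq, hp, hq⟩ := h.app_dest
        obtain ⟨a', ha', hp'⟩ := hp.lam_dest
        exact (InfClosure.substAt_zero (fun σ hσ s t h => h.subst_of_rule hsub hσ) hp' hq).prepend
          ((hpq.trans (reflTransGen_compat_appL q ha')).tail (.base (hβ _ _ (.mk a' q))))
    · exact h'
  | appL _ ih =>
    obtain ⟨p, q, hpq, hp, hq⟩ := h.app_dest
    exact .of_rule (.app hpq (ih _ hp) hq)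
  | appR _ ih =>
    obtain ⟨p, q, hpq, hp, hq⟩ := h.app_dest
    exact .of_rule (.app hpq hp (ih _ hq))
  | lam _ ih =>
    obtain ⟨p, hpq, hp⟩ := h.lam_dest
    exact .of_rule (.lam hpq (ih _ hp))

theorem BetaRule.subst {s t : Term C} (h : BetaRule s t) (σ : ℕ → Term C) :
    BetaRule (s.subst σ) (t.subst σ) := by
  cases h with
  | mk a b =>
    rw [subst_app, subst_lam, subst_substAt_zero]
    exact .mk _ _

theorem appendable_beta : Appendable (Compat (BetaRule (C := C))) :=
  appendable_of_rule (fun _ _ h => h) (fun σ _ _ _ h => .single (.base (h.subst σ)))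
    fun _ _ _ _ h => .inl h

/-! ### Parallel contraction of meaningless subterms -/

theorem ParRule.mono {R X Y : Term C → Term C → Prop} (h : ∀ s t, X s t → Y s t) {s t : Term C} :
    ParRule R X s t → ParRule R Y s t
  | .base hR => .base hR
  | .atom ha => .atom ha
  | .app h₁ h₂ => .app (h _ _ h₁) (h _ _ h₂)
  | .lam h₁ => .lam (h _ _ h₁)

theorem Par.dest {R : Term C → Term C → Prop} {s t : Term C} (h : Par R s t) :
    ParRule R (Par R) s t := by
  obtain ⟨X, hX, h⟩ := h
  exact (hX _ _ h).mono fun _ _ h => ⟨X, hX, h⟩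

/-- Coinduction up to `Par R`: premises may also be found in the closure itself. -/
theorem Par.coind {R : Term C → Term C → Prop} (X : Term C → Term C → Prop)
    (hX : ∀ s t, X s t → ParRule R (fun a b => Par R a b ∨ X a b) s t)
    {s t : Term C} (h : X s t) : Par R s t := by
  refine ⟨fun a b => Par R a b ∨ X a b, ?_, .inr h⟩
  rintro s t (h | h)
  · exact h.dest.mono fun _ _ h => .inl h
  · exact hX _ _ h

theorem Par.of_rule {R : Term C → Term C → Prop} {s t : Term C} (h : ParRule R (Par R) s t) :
    Par R s t :=
  .coind (ParRule R (Par R)) (fun _ _ h => h.mono fun _ _ h => .inl h) h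

theorem Par.refl (R : Term C → Term C → Prop) (t : Term C) : Par R t t := by
  refine .coind (fun a b => a = b) ?_ rfl
  rintro t _ rfl
  rcases atom_or_app_or_lam t with h | ⟨a, b, rfl⟩ | ⟨a, rfl⟩
  · exact .atom h
  · exact .app (.inr rfl) (.inr rfl)
  · exact .lam (.inr rfl)

/-- `ParBot U s t`: the term `t` arises from `s` by replacing any number of disjoint subterms in
`U` by `bot`. -/
def ParBot (U : Set (Term C)) : Term C → Term C → Prop := Par fun a b => a ∈ U ∧ b = bot

section ParBot

variable {U : Set (Term C)}

theorem ParBot.atom_dest {s a : Term C} (ha : IsAtom a) (h : ParBot U s a) :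
    s = a ∨ s ∈ U ∧ a = bot := by
  cases h.dest with
  | base h₁ => exact .inr h₁
  | atom => exact .inl rfl
  | app => simp at ha
  | lam => simp at ha

theorem ParBot.app_dest {s a b : Term C} (h : ParBot U s (app a b)) :
    ∃ p q, s = app p q ∧ ParBot U p a ∧ ParBot U q b := by
  generalize he : app a b = t at h
  cases h.dest with
  | base h₁ => simp [h₁.2] at he
  | atom h₁ => simp [← he] at h₁
  | app h₁ h₂ =>
    obtain ⟨rfl, rfl⟩ := app_inj.1 he
    exact ⟨_, _, rfl, h₁, h₂⟩
  | lam => simp at he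

theorem ParBot.lam_dest {s a : Term C} (h : ParBot U s (lam a)) :
    ∃ p, s = lam p ∧ ParBot U p a := by
  generalize he : lam a = t at h
  cases h.dest with
  | base h₁ => simp [h₁.2] at he
  | atom h₁ => simp [← he] at h₁
  | app => simp at he
  | lam h₁ =>
    obtain rfl := lam_inj.1 he
    exact ⟨_, rfl, h₁⟩

theorem ParBot.subst
    (S : (ℕ → Term C) → (ℕ → Term C) → Prop) (hup : ∀ σ τ, S σ τ → S (upSub σ) (upSub τ))
    (hpt : ∀ σ τ, S σ τ → ∀ n, ParBot U (σ n) (τ n))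
    (hU : ∀ σ τ, S σ τ → ∀ s ∈ U, s.subst σ ∈ U)
    {σ τ : ℕ → Term C} (hS : S σ τ) {s t : Term C} (h : ParBot U s t) :
    ParBot U (s.subst σ) (t.subst τ) := by
  refine Par.coind
    (fun a b => ∃ σ τ s t, S σ τ ∧ ParBot U s t ∧ a = s.subst σ ∧ b = t.subst τ) ?_
    ⟨σ, τ, s, t, hS, h, rfl, rfl⟩
  rintro _ _ ⟨σ, τ, s, t, hS, h, rfl, rfl⟩
  cases h.dest with
  | base h₁ => exact .base ⟨hU _ _ hS _ h₁.1, by rw [h₁.2, subst_bot]⟩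
  | atom ha =>
    rcases ha with ⟨n, rfl⟩ | rfl | ⟨c, rfl⟩
    · rw [subst_var, subst_var]
      exact (hpt σ τ hS n).dest.mono fun _ _ h => .inl h
    · rw [subst_bot, subst_bot]
      exact .atom isAtom_bot
    · rw [subst_const, subst_const]
      exact .atom (isAtom_const c)
  | app h₁ h₂ =>
    rw [subst_app, subst_app]
    exact .app (.inr ⟨_, _, _, _, hS, h₁, rfl, rfl⟩) (.inr ⟨_, _, _, _, hS, h₂, rfl, rfl⟩)
  | lam h₁ =>
    rw [subst_lam, subst_lam]
    exact .lam (.inr ⟨_, _, _, _, hup _ _ hS, h₁, rfl, rfl⟩)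

theorem ParBot.substAt_zero (hU : ∀ σ, BasicSub σ → ∀ s ∈ U, s.subst σ ∈ U)
    {s s' t t' : Term C} (hs : ParBot U s s') (ht : ParBot U t t') :
    ParBot U (s.substAt 0 t) (s'.substAt 0 t') := by
  have hshift : ∀ {a b}, ParBot U a b → ParBot U (shift a) (shift b) := by
    intro a b hab
    have := ParBot.subst (fun σ τ => σ = τ ∧ ∃ k, σ = renSub (upRen^[k] Nat.succ))
      (by
        rintro σ _ ⟨rfl, k, rfl⟩
        refine ⟨rfl, k + 1, ?_⟩
        rw [upSub_renSub, ← Function.iterate_succ_apply' upRen])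
      (by rintro σ _ ⟨rfl, -⟩ n; exact Par.refl _ _)
      (by rintro σ _ ⟨rfl, k, rfl⟩; exact hU _ (.fresh k))
      ⟨rfl, 0, rfl⟩ hab
    simpa [subst_renSub, shift] using this
  refine ParBot.subst (fun σ τ => ∃ n a b, ParBot U a b ∧ σ = single n a ∧ τ = single n b)
    ?_ ?_ ?_ ⟨0, t, t', ht, rfl, rfl⟩ hs
  · rintro _ _ ⟨n, a, b, hab, rfl, rfl⟩
    exact ⟨n + 1, _, _, hshift hab, upSub_single _ _, upSub_single _ _⟩
  · rintro _ _ ⟨n, a, b, hab, rfl, rfl⟩ m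
    unfold single
    split_ifs
    exacts [Par.refl _ _, hab, Par.refl _ _]
  · rintro _ _ ⟨n, a, b, -, rfl, rfl⟩
    exact hU _ (.single n a)

/-- A `β`-step after a parallel contraction of meaningless subterms can be performed before it:
the contraction creates no abstraction, hence no `β`-redex. -/
theorem ParBot.beta_step (hU : ∀ σ, BasicSub σ → ∀ s ∈ U, s.subst σ ∈ U)
    {s t t' : Term C} (h : ParBot U s t) (h' : Compat BetaRule t t') :
    ∃ s', Compat BetaRule s s' ∧ ParBot U s' t' := by
  induction h' generalizing s with
  | base hb =>
    cases hb with
    | mk a b =>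
      obtain ⟨p, q, rfl, hp, hq⟩ := h.app_dest
      obtain ⟨p', rfl, hp'⟩ := hp.lam_dest
      exact ⟨_, .base (.mk p' q), hp'.substAt_zero hU hq⟩
  | appL _ ih =>
    obtain ⟨p, q, rfl, hp, hq⟩ := h.app_dest
    obtain ⟨p', hp', hp''⟩ := ih hp
    exact ⟨_, hp'.appL, Par.of_rule (.app hp'' hq)⟩
  | appR _ ih =>
    obtain ⟨p, q, rfl, hp, hq⟩ := h.app_dest
    obtain ⟨q', hq', hq''⟩ := ih hq
    exact ⟨_, hq'.appR, Par.of_rule (.app hp hq'')⟩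
  | lam _ ih =>
    obtain ⟨p, rfl, hp⟩ := h.lam_dest
    obtain ⟨p', hp', hp''⟩ := ih hp
    exact ⟨_, hp'.lam, Par.of_rule (.lam hp'')⟩

theorem compat_betaBot_dest {s t : Term C} (h : Compat (BetaBotRule U) s t) :
    Compat BetaRule s t ∨ ParBot U s t := by
  induction h with
  | base h =>
    rcases h with h | ⟨h, -, h'⟩
    · exact .inl (.base h)
    · exact .inr (Par.of_rule (.base ⟨h, h'⟩))
  | appL _ ih => exact ih.imp .appL fun h => Par.of_rule (.app h (Par.refl _ _))
  | appR _ ih => exact ih.imp .appR fun h => Par.of_rule (.app (Par.refl _ _) h)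
  | lam _ ih => exact ih.imp .lam fun h => Par.of_rule (.lam h)

end ParBot

/-! ### Reduction to a meaningless term -/

theorem iterate_upRen_succ (k m : ℕ) :
    (upRen^[k] Nat.succ) m = if m < k then m else m + 1 := by
  induction k generalizing m with
  | zero => simp
  | succ k ih =>
    rw [Function.iterate_succ_apply']
    cases m with
    | zero => simp [upRen]
    | succ m =>
      simp only [upRen, ih]
      split_ifs <;> omega

namespace Meaningless

variable {U : Set (Term C)}

theorem rename_add_mem (hU : Meaningless U) {t : Term C} (ht : t ∈ U) (n : ℕ) :
    rename (fun m => m + n) t ∈ U := by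
  induction n with
  | zero =>
    have h : rename (fun m => m + 0) t = t :=
      (subst_renSub (fun m => m + 0) t).symm.trans (subst_var_eq_self t)
    rw [h]
    exact ht
  | succ n ih =>
    have := hU.substitution_shift _ ih
    rwa [shift, rename_rename] at this

/-- Closure under `substAt` and `shift` gives closure under insertion of a fresh index `k`:
after all indices have been raised by `k + 1`, those that were below `k` are restored one by
one. -/
theorem rename_fresh_mem (hU : Meaningless U) {t : Term C} (ht : t ∈ U) (k : ℕ) :
    rename (upRen^[k] Nat.succ) t ∈ U := by
  have key : ∀ j ≤ k, rename (fun m => if m < j then m else m + (k + 1 - j)) t ∈ U := by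
    intro j hj
    induction j with
    | zero => simpa using hU.rename_add_mem ht (k + 1)
    | succ j ih =>
      have := hU.substitution _ (ih (by omega)) (k + 1) (var j)
      rw [substAt_eq, subst_rename] at this
      rw [← subst_renSub]
      convert this using 2
      funext m
      rcases lt_trichotomy m j with h | h | h
      · have h₁ : m < k + 1 := by omega
        have h₂ : m < j + 1 := by omega
        simp [renSub, single, h, h₁, h₂]
      · have h₃ : j + (k + 1 - j) = k + 1 := by omega
        simp [renSub, single, h, h₃]
      · have h₁ : ¬ m < j := by omega
        have h₂ : ¬ m < j + 1 := by omega
        have h₃ : ¬ m + (k + 1 - j) < k + 1 := by omega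
        have h₄ : m + (k + 1 - j) ≠ k + 1 := by omega
        have h₅ : m + (k - j) = m + (k + 1 - j) - 1 := by omega
        simp [renSub, single, h₁, h₂, h₃, h₄, h₅]
  have := key k le_rfl
  rwa [show (fun m => if m < k then m else m + (k + 1 - k)) = upRen^[k] Nat.succ from
    funext fun m => by rw [iterate_upRen_succ, Nat.add_sub_cancel_left]] at this

theorem subst_mem (hU : Meaningless U) {σ : ℕ → Term C} (hσ : BasicSub σ) {t : Term C}
    (ht : t ∈ U) : t.subst σ ∈ U := by
  cases hσ with
  | fresh k => rw [subst_renSub]; exact hU.rename_fresh_mem ht k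
  | single n s => exact hU.substitution t ht n s

/-- The constant `bot` is root-active: it is its only reduct, and not a root normal form. -/
theorem bot_mem (hU : Meaningless U) : (bot : Term C) ∈ U := by
  apply hU.root_active
  rintro ⟨t, ht, hrnf⟩
  have hstep : ∀ {s t : Term C}, Compat BetaRule s t → s ≠ bot := by
    intro s t h
    cases h with
    | base h => cases h; simp
    | appL | appR | lam => simp
  have hred : ∀ {t : Term C}, ReflTransGen (Compat BetaRule) bot t → t = bot := by
    intro t h
    rcases h.cases_head with h | ⟨_, h, -⟩
    · exact h.symm
    · exact absurd rfl (hstep h)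
  have : t = bot := by
    cases ht.dest with
    | atom _ h => exact hred h
    | app h => simpa using hred h
    | lam h => simpa using hred h
  subst this
  rcases hrnf with ⟨-, h⟩ | ⟨_, h⟩ | ⟨_, _, h, -⟩
  · exact h rfl
  · simpa using h.symm
  · simpa using h.symm

/-- Indiscernibility, as the contracted subterms and `bot` are all in `U`. -/
theorem mem_of_parBot (hU : Meaningless U) {s t : Term C} (h : ParBot U s t) (ht : t ∈ U) :
    s ∈ U := by
  refine hU.indiscernibility t s ht (.coind (fun a b => ParBot U b a) (fun a b h => ?_) h)
  cases h.dest with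
  | base h₁ => exact .base ⟨h₁.2 ▸ hU.bot_mem, h₁.1⟩
  | atom ha => exact .atom ha
  | app h₁ h₂ => exact .app (.inr h₁) (.inr h₂)
  | lam h₁ => exact .lam (.inr h₁)

/-- A subterm in `U` of an intermediate term arises from a subterm that is itself in `U`, by
`mem_of_parBot`. -/
theorem parBot_trans (hU : Meaningless U) {s t u : Term C} (h : ParBot U s t)
    (h' : ParBot U t u) : ParBot U s u := by
  refine Par.coind (fun a c => ∃ b, ParBot U a b ∧ ParBot U b c) ?_ ⟨t, h, h'⟩
  rintro s u ⟨t, h, h'⟩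
  cases h'.dest with
  | base h₁ => exact .base ⟨hU.mem_of_parBot h h₁.1, h₁.2⟩
  | atom ha => exact h.dest.mono fun _ _ h => .inl h
  | app h₁ h₂ =>
    obtain ⟨p, q, rfl, hp, hq⟩ := h.app_dest
    exact .app (.inr ⟨_, hp, h₁⟩) (.inr ⟨_, hq, h₂⟩)
  | lam h₁ =>
    obtain ⟨p, rfl, hp⟩ := h.lam_dest
    exact .lam (.inr ⟨_, hp, h₁⟩)

/-- Postponement of contractions to `bot` for finite reductions. -/
theorem parBot_postpone (hU : Meaningless U) {s t u : Term C} (h : ParBot U s t)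
    (h' : ReflTransGen (Compat (BetaBotRule U)) t u) :
    ∃ r, ReflTransGen (Compat BetaRule) s r ∧ ParBot U r u := by
  induction h' with
  | refl => exact ⟨s, .refl, h⟩
  | tail _ hstep ih =>
    obtain ⟨r, hr, hr'⟩ := ih
    rcases compat_betaBot_dest hstep with hb | hp
    · obtain ⟨r', h₁, h₂⟩ := hr'.beta_step (fun σ hσ s hs => hU.subst_mem hσ hs) hb
      exact ⟨r', hr.tail h₁, h₂⟩
    · exact ⟨r, hr, hU.parBot_trans hr' hp⟩

end Meaningless

/-- Construction of terms by corecursion from a total relation: if for every state there is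
a finished term related to it by `P`, or a root and successor states related to it by `A` or `L`,
then the states can be mapped to terms according to these choices. -/
theorem Term.exists_corec {α : Type*} (P : α → Term C → Prop) (A : α → α → α → Prop)
    (L : α → α → Prop) (h : ∀ x, (∃ t, P x t) ∨ (∃ y z, A x y z) ∨ ∃ y, L x y) :
    ∃ F : α → Term C, ∀ x, P x (F x) ∨ (∃ y z, A x y z ∧ F x = app (F y) (F z)) ∨
      ∃ y, L x y ∧ F x = lam (F y) := by
  have hg : ∀ x, ∃ n : (sig C).Obj (Term C ⊕ α), (∃ t, P x t ∧ n = (sig C).map .inl (dest t)) ∨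
      (∃ y z, A x y z ∧ n = ⟨Label.app, fun i : Bool => if i then .inr z else .inr y⟩) ∨
      ∃ y, L x y ∧ n = ⟨Label.lam, fun _ : Unit => .inr y⟩ := by
    intro x
    rcases h x with ⟨t, h⟩ | ⟨y, z, h⟩ | ⟨y, h⟩
    exacts [⟨_, .inl ⟨t, h, rfl⟩⟩, ⟨_, .inr (.inl ⟨y, z, h, rfl⟩)⟩, ⟨_, .inr (.inr ⟨y, h, rfl⟩)⟩]
  choose g hg using hg
  let step : Term C ⊕ α → (sig C).Obj (Term C ⊕ α) :=
    Sum.elim (fun t => (sig C).map .inl (dest t)) g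
  let G : Term C ⊕ α → Term C := PFunctor.M.corec step
  have hG : ∀ x, dest (G x) = (sig C).map G (step x) := fun x => PFunctor.M.dest_corec _ _
  have hinl : ∀ t, G (.inl t) = t := by
    intro t
    refine PFunctor.M.bisim (P := sig C) (fun a b => a = G (.inl b)) ?_ _ _ rfl
    rintro _ y rfl
    exact ⟨(dest y).1, _, (dest y).2, hG _, rfl, fun i => rfl⟩
  refine ⟨fun x => G (.inr x), fun x => ?_⟩
  have hx : dest (G (.inr x)) = (sig C).map G (g x) := hG _
  rcases hg x with ⟨t, h, hn⟩ | ⟨y, z, h, hn⟩ | ⟨y, h, hn⟩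
  · have : G (.inr x) = t := by
      apply ext_dest
      rw [hx, hn]
      exact congrArg (fun f => (sig C).map f (dest t)) (funext hinl)
    subst this
    exact .inl h
  · refine .inr (.inl ⟨y, z, h, ?_⟩)
    apply ext_dest
    rw [hx, hn, dest_app]
    refine congrArg (Sigma.mk Label.app) (funext fun i : Bool => ?_)
    cases i <;> rfl
  · refine .inr (.inr ⟨y, h, ?_⟩)
    apply ext_dest
    rw [hx, hn, dest_lam]
    rfl

/-- Contractions of meaningless subterms can be postponed to the end of an infinitary reduction.
The intermediate term is constructed corecursively. -/
theorem Meaningless.infClosure_postpone {U : Set (Term C)} (hU : Meaningless U) {s u : Term C}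
    (h : InfBetaBot U s u) : ∃ r, InfBeta s r ∧ ParBot U r u := by
  let Y := {p : Term C × Term C // ∃ t, ParBot U p.1 t ∧ InfBetaBot U t p.2}
  obtain ⟨F, hF⟩ := Term.exists_corec (α := Y)
    (fun x r => ReflTransGen (Compat BetaRule) x.1.1 r ∧ ParBot U r x.1.2)
    (fun x y z => ReflTransGen (Compat BetaRule) x.1.1 (app y.1.1 z.1.1) ∧
      x.1.2 = app y.1.2 z.1.2)
    (fun x y => ReflTransGen (Compat BetaRule) x.1.1 (lam y.1.1) ∧ x.1.2 = lam y.1.2) (by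
      rintro ⟨⟨s, u⟩, t, hst, htu⟩
      dsimp only at hst htu
      rcases htu.dest with ⟨-, ht⟩ | ⟨ht, h₁, h₂⟩ | ⟨ht, h₁⟩
      · exact .inl (hU.parBot_postpone hst ht)
      · obtain ⟨r, hr, hr'⟩ := hU.parBot_postpone hst ht
        obtain ⟨p, q, rfl, hp, hq⟩ := hr'.app_dest
        exact .inr (.inl ⟨⟨(p, _), _, hp, h₁⟩, ⟨(q, _), _, hq, h₂⟩, hr, rfl⟩)
      · obtain ⟨r, hr, hr'⟩ := hU.parBot_postpone hst ht
        obtain ⟨p, rfl, hp⟩ := hr'.lam_dest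
        exact .inr (.inr ⟨⟨(p, _), _, hp, h₁⟩, hr, rfl⟩))
  refine ⟨F ⟨(s, u), s, Par.refl _ _, h⟩, ?_, ?_⟩
  · refine InfClosure.coind (fun a b => ∃ x : Y, a = x.1.1 ∧ b = F x) ?_ ⟨_, rfl, rfl⟩
    rintro _ _ ⟨x, rfl, rfl⟩
    rcases hF x with h | ⟨y, z, h, he⟩ | ⟨y, h, he⟩
    · exact (InfClosure.of_reflTransGen h.1).dest.mono fun _ _ h => .inl h
    · rw [he]
      exact .app h.1 (.inr ⟨y, rfl, rfl⟩) (.inr ⟨z, rfl, rfl⟩)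
    · rw [he]
      exact .lam h.1 (.inr ⟨y, rfl, rfl⟩)
  · refine Par.coind (fun a b => ∃ x : Y, a = F x ∧ b = x.1.2) ?_ ⟨_, rfl, rfl⟩
    rintro _ _ ⟨x, rfl, rfl⟩
    rcases hF x with h | ⟨y, z, h, he⟩ | ⟨y, h, he⟩
    · exact h.2.dest.mono fun _ _ h => .inl h
    · rw [he, h.2]
      exact .app (.inr ⟨y, rfl, rfl⟩) (.inr ⟨z, rfl, rfl⟩)
    · rw [he, h.2]
      exact .lam (.inr ⟨y, rfl, rfl⟩)

/-- Closure of `U` under infinitary Böhm expansion, of which the expansion axiom is the case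
without contractions to `bot`. -/
theorem StronglyMeaningless.mem_of_infBetaBot {U : Set (Term C)} (hU : StronglyMeaningless U)
    {s t : Term C} (h : InfBetaBot U s t) (ht : t ∈ U) : s ∈ U := by
  obtain ⟨r, hr, hr'⟩ := hU.toMeaningless.infClosure_postpone h
  exact hU.expansion r s (hU.toMeaningless.mem_of_parBot hr' ht) hr

theorem appendable_betaBot {U : Set (Term C)} (hU : StronglyMeaningless U) :
    Appendable (Compat (BetaBotRule U)) := by
  have hbot : ∀ t ∈ U, ReflTransGen (Compat (BetaBotRule U)) t bot := by
    intro t ht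
    by_cases h : t = bot
    · rw [h]
    · exact .single (.base (.inr ⟨ht, h, rfl⟩))
  refine appendable_of_rule (fun _ _ h => .inl h) ?_ ?_
  · rintro σ hσ s t (h | ⟨h, -, rfl⟩)
    · exact .single (.base (.inl (h.subst σ)))
    · rw [subst_bot]
      exact hbot _ (hU.toMeaningless.subst_mem hσ h)
  · rintro t₁ t₂ t₃ h (hb | ⟨h₂, -, rfl⟩)
    · exact .inl hb
    · exact .inr (.of_reflTransGen (hbot _ (hU.mem_of_infBetaBot h h₂)))

end InfLambda

theorem mainTheorem9 {C : Type u} :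
    (∀ R : InfLambda.Term C → InfLambda.Term C → Prop,
      InfLambda.Appendable (InfLambda.Compat R) →
      ∀ (s t : InfLambda.Term C) (ζ : Ordinal.{v}),
        Nonempty (InfLambda.StrongConvSeq R ζ s t) →
        ∃ ξ : Ordinal.{v}, ξ ≤ Ordinal.omega0 ∧ Nonempty (InfLambda.StrongConvSeq R ξ s t)) ∧
    (∀ U : Set (InfLambda.Term C), InfLambda.StronglyMeaningless U →
      ∀ s t : InfLambda.Term C,
        InfLambda.InfBetaBot U s t ↔
          ∃ ζ : Ordinal.{v},
            Nonempty (InfLambda.StrongConvSeq (InfLambda.BetaBotRule U) ζ s t)) ∧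
    (∀ s t : InfLambda.Term C,
      InfLambda.InfBeta s t ↔
        ∃ ζ : Ordinal.{v}, Nonempty (InfLambda.StrongConvSeq InfLambda.BetaRule ζ s t)) := by
  have key : ∀ R : InfLambda.Term C → InfLambda.Term C → Prop,
      InfLambda.Appendable (InfLambda.Compat R) →
      ∀ s t, InfLambda.InfClosure (InfLambda.Compat R) s t ↔
        ∃ ζ : Ordinal.{v}, Nonempty (InfLambda.StrongConvSeq R ζ s t) := by
    refine fun R hR s t => ⟨fun h => ?_, fun ⟨ζ, ⟨S⟩⟩ => S.infClosure hR⟩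
    obtain ⟨ξ, -, hξ⟩ := h.exists_strongConvSeq
    exact ⟨ξ, hξ⟩
  -- The infinitary closure forgets the length of the sequence, and gives back one of length `≤ ω`.
  exact ⟨fun R hR s t ζ ⟨S⟩ => (S.infClosure hR).exists_strongConvSeq,
    fun U hU => key _ (InfLambda.appendable_betaBot hU), key _ InfLambda.appendable_beta⟩
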